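/- **Model.** Messages of classes $1,\dots,J$ queue for a common receiver; time is slotted, one slot being one complex channel use (there are $W$ of them per second on a band of width $W$, so nats per slot are nats/s/Hz). Class $j$ has received power $P_j>0$, message alphabet size $M_j\ge 2$ and tolerable decoding error probability $p_{e,j}\in(0,1]$; the noise power is $N_0W>0$, and $\Gamma_j=P_j/(N_0W)$. At most $\mathsf K\ge 1$ messages are transmitted simultaneously; a schedule is $s\in\mathbb Z_+^J$ with $\sum_j s_j\le\mathsf K$. For $\rho\in(0,1]$ a class-$j$ message arrives with service requirement $S_j=-\ln p_{e,j}+\rho\ln M_j$, and under independent decoding with Gaussian encoding each scheduled class-$j$ message receives in one slot, under the schedule $s$, the service quantum $$\phi_j(s)=\rho\ln\Bigl(1+\frac{P_j}{(1+\rho)\bigl(\sum_k s_kP_k-P_j+N_0W\bigr)}\Bigr)\quad (s_j>0),\qquad \phi_j(s)=0\quad (s_j=0).$$ The state records, for each class, the ordered list of the residual service requirements of the messages present. These residuals are positive and equal $S_j$ minus a sum of finitely many quanta. In each slot a schedule $s$, with $s_j$ at most the number of class-$j$ messages present, is chosen by a stationary (possibly randomized) policy depending on the state; the first $s_j$ messages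 of queue $j$ are served, those whose requirement is met leave, and then $A_j$ new class-$j$ messages join the tail of queue $j$. The batch sizes $A_j$ are independent over classes and slots, identically distributed over slots, with $\mathbb E A_j^2<\infty$. The policy is non-idling ($\omega\in\Omega_{\mathsf K}$): it schedules exactly $\mathsf K$ messages whenever at least $\mathsf K$ are present. The chain is considered on a closed set of states on which it is irreducible. It is *stable* if it is positive recurrent and the number of messages has finite stationary mean, and *unstable* if it is transient. The total nat arrival rate is $\sum_j\mathbb E\tilde A_j=\sum_j(\ln M_j)\,\mathbb E A_j$. Say that the system is *stable below $t$* if for all batch laws, all $\omega\in\Omega_{\mathsf K}$ and all such state sets the chain is stable whenever $\sum_j\mathbb E\tilde A_j<t$, and *unstable above $t$* if it is always unstable whenever $\sum_j\mathbb E\tilde A_j>t$ and the number of messages is unbounded on the state set. **Theorem.** (i) Let $J=1$, and let $\mathsf K\ge1$, $P_1$, $N_0$, $W$, $p_{e,1}$ be fixed. For all $\rho\in(0,1]$ and $M_1\ge2$ there is a threshold $T(\rho,M_1)$ such that the system is stable below $T(\rho,M_1)$ and unstable above $T(\rho,M_1)$. These can be chosen so that for each $\rho\in(0,1]$ the limit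 $L(\rho)=\lim_{M_1\to\infty}T(\rho,M_1)$ exists, and $$\lim_{\rho\downarrow0}L(\rho)=\mathsf K\ln\Bigl(1+\frac{\Gamma_1}{(\mathsf K-1)\Gamma_1+1}\Bigr).$$ (ii) Let $J\ge1$, and let $P_j$, $p_{e,j}$ $(1\le j\le J)$, $N_0$, $W$ be fixed. There is a function $L$ with $\lim_{\rho\downarrow0}L(\rho)=1$ (nat/s/Hz) such that, for every $\rho\in(0,1]$, as first $\mathsf K\to\infty$ and then $\min_jM_j\to\infty$, the stability threshold on the total nat arrival rate tends to $L(\rho)$: for every $\varepsilon>0$ there is $M_0$ such that, for all $M_1,\dots,M_J\ge M_0$, for all sufficiently large $\mathsf K$ the system is stable below $L(\rho)-\varepsilon$ and unstable above $L(\rho)+\varepsilon$. -/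

import Mathlib

open Filter Topology
open scoped ENNReal

/-! ## Markov chains on a countable set of states

A chain is given by its transition law `P : X → PMF X`. -/

namespace MarkovChain

variable {X : Type*}

/-- `C` is the state space of an irreducible chain: it is non-empty, it is closed under the
transitions of `P`, and every state of `C` leads to every state of `C`. -/
structure IrreducibleOn (P : X → PMF X) (C : Set X) : Prop where
  nonempty : C.Nonempty
  closed : ∀ x ∈ C, ∀ y, P x y ≠ 0 → y ∈ C
  communicate : ∀ x ∈ C, ∀ y ∈ C, Relation.ReflTransGen (fun a b => P a b ≠ 0) x y

open Classical in
/-- `firstPassage P y n x` is the probability that the chain started in `x` visits `y` at time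
`n + 1` and not at any of the times `1, …, n`. -/
noncomputable def firstPassage (P : X → PMF X) (y : X) : ℕ → X → ℝ≥0∞
  | 0, x => P x y
  | n + 1, x => ∑' z, if z = y then 0 else P x z * firstPassage P y n z

/-- The probability that the chain started in `x` ever returns to `x`. -/
noncomputable def returnProb (P : X → PMF X) (x : X) : ℝ≥0∞ :=
  ∑' n, firstPassage P x n x

/-- `E[τ ; τ < ∞]` for the first return time `τ` of the chain started in `x`. It is the mean
return time when the return probability is `1`. -/
noncomputable def meanReturnTime (P : X → PMF X) (x : X) : ℝ≥0∞ :=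
  ∑' n : ℕ, ((n : ℝ≥0∞) + 1) * firstPassage P x n x

/-- The chain with state space `C` is positive recurrent. -/
def PositiveRecurrentOn (P : X → PMF X) (C : Set X) : Prop :=
  ∀ x ∈ C, returnProb P x = 1 ∧ meanReturnTime P x ≠ ⊤

/-- The chain with state space `C` is transient. -/
def TransientOn (P : X → PMF X) (C : Set X) : Prop :=
  ∀ x ∈ C, returnProb P x < 1

/-- `μ` is a stationary probability measure of the chain with state space `C`. -/
def StationaryOn (P : X → PMF X) (C : Set X) (μ : PMF X) : Prop :=
  μ.support ⊆ C ∧ μ.bind P = μ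

end MarkovChain

/-! ## The multi-class processor-sharing queue -/

/-- `s j` is the number of class-`j` messages scheduled for simultaneous transmission. -/
abbrev Schedule (J : ℕ) := Fin J → ℕ

/-- `α j` is the list, from the head of queue `j`, of the residual service requirements of the
class-`j` messages present in the system. -/
abbrev Config (J : ℕ) := Fin J → List ℝ

/-- The number of messages in the system. -/
def Config.count {J : ℕ} (α : Config J) : ℕ := ∑ j, (α j).length

/-- The parameters of multiaccess communication with independent decoding and Gaussian encoding:
at most `K` messages are transmitted simultaneously, `ρ` is the parameter of the random coding
bound, `noise` is the noise power `N₀ W`, and class `j` has received power `power j`, message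
alphabet size `M j` and tolerable decoding error probability `pe j`. -/
structure Model (J : ℕ) where
  K : ℕ
  ρ : ℝ
  noise : ℝ
  power : Fin J → ℝ
  M : Fin J → ℕ
  pe : Fin J → ℝ

namespace Model

variable {J : ℕ} (m : Model J)

/-- The service requirement of a class-`j` message. -/
noncomputable def requirement (j : Fin J) : ℝ :=
  -Real.log (m.pe j) + m.ρ * Real.log (m.M j)

/-- The service quantum that each scheduled class-`j` message receives in one time slot (one
channel use) under the schedule `s`: the random coding exponent for Gaussian encoding, when the
other scheduled messages are treated as noise. -/
noncomputable def quantum (s : Schedule J) (j : Fin J) : ℝ :=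
  if s j = 0 then 0
  else m.ρ * Real.log
    (1 + m.power j / ((1 + m.ρ) * ((∑ k, (s k : ℝ) * m.power k) - m.power j + m.noise)))

/-- The schedules with at most `K` messages. -/
def schedules : Finset (Schedule J) :=
  (Fintype.piFinset fun _ => Finset.range (m.K + 1)).filter fun s => ∑ j, s j ≤ m.K

/-- The states: every message present has a positive residual requirement, which is the full
requirement of its class minus the quanta received in finitely many slots. -/
def states : Set (Config J) :=
  {α | ∀ j, ∀ x ∈ α j, 0 < x ∧
    ∃ d : Schedule J → ℕ, x = m.requirement j - ∑ s ∈ m.schedules, (d s : ℝ) * m.quantum s j}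

/-- One time slot: the first `s j` messages of each queue `j` are served, those whose requirement
is met leave, and then `a j` new messages join queue `j` at the tail. -/
noncomputable def step (α : Config J) (s : Schedule J) (a : Fin J → ℕ) : Config J := fun j =>
  (((α j).take (s j)).map fun x => x - m.quantum s j).filter (fun x => 0 < x)
    ++ (α j).drop (s j) ++ List.replicate (a j) (m.requirement j)

/-- `ω` is a (randomized, stationary) non-idling policy: it implements feasible schedules of at
most `K` messages, and of exactly `K` messages whenever at least `K` messages are present. -/
structure NonIdling (ω : Config J → PMF (Schedule J)) : Prop where
  le_K : ∀ α ∈ m.states, ∀ s, ω α s ≠ 0 → ∑ j, s j ≤ m.K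
  feasible : ∀ α ∈ m.states, ∀ s, ω α s ≠ 0 → ∀ j, s j ≤ (α j).length
  eq_K : ∀ α ∈ m.states, m.K ≤ α.count → ∀ s, ω α s ≠ 0 → ∑ j, s j = m.K

end Model

/-- The law of the vector of batch sizes in a slot: independent, class `j` having law `p j`. -/
noncomputable def batchLaw {J : ℕ} (p : Fin J → PMF ℕ) : PMF (Fin J → ℕ) :=
  (MeasureTheory.Measure.pi fun j => (p j).toMeasure).toPMF

/-- The mean batch size (the arrival rate). -/
noncomputable def meanBatch (p : PMF ℕ) : ℝ := (∑' k : ℕ, (k : ℝ≥0∞) * p k).toReal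

/-- The batch size has a finite second moment (hence a finite mean). -/
def FiniteSecondMoment (p : PMF ℕ) : Prop := ∑' k : ℕ, (k : ℝ≥0∞) ^ 2 * p k ≠ ⊤

namespace Model

variable {J : ℕ} (m : Model J)

/-- The transition law of the queue under the policy `ω`: the state is read, a schedule is
drawn and implemented, and then the new arrivals are admitted. -/
noncomputable def chain (p : Fin J → PMF ℕ) (ω : Config J → PMF (Schedule J)) :
    Config J → PMF (Config J) := fun α =>
  (ω α).bind fun s => (batchLaw p).map fun a => m.step α s a

/-- The total nat arrival rate, the sum over the classes of `ln M_j` times the message arrival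
rate. -/
noncomputable def natRate (p : Fin J → PMF ℕ) : ℝ :=
  ∑ j, Real.log (m.M j) * meanBatch (p j)

/-- The chain on the state space `C` is stable: it is positive recurrent and the number of
messages in the system has finite stationary mean. -/
def Stable (p : Fin J → PMF ℕ) (ω : Config J → PMF (Schedule J)) (C : Set (Config J)) : Prop :=
  MarkovChain.PositiveRecurrentOn (m.chain p ω) C ∧
    ∃ μ : PMF (Config J), MarkovChain.StationaryOn (m.chain p ω) C μ ∧
      ∑' α, μ α * (α.count : ℝ≥0∞) ≠ ⊤

/-- The chain on the state space `C` is unstable: it is transient. -/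
def Unstable (p : Fin J → PMF ℕ) (ω : Config J → PMF (Schedule J)) (C : Set (Config J)) : Prop :=
  MarkovChain.TransientOn (m.chain p ω) C

/-- Whatever the batch laws, the non-idling policy and the state space on which the resulting
chain is irreducible, the chain is stable if the total nat arrival rate is below `t`. -/
def StableBelow (t : ℝ) : Prop :=
  ∀ (p : Fin J → PMF ℕ) (ω : Config J → PMF (Schedule J)) (C : Set (Config J)),
    (∀ j, FiniteSecondMoment (p j)) → m.NonIdling ω → C ⊆ m.states →
    MarkovChain.IrreducibleOn (m.chain p ω) C → m.natRate p < t → m.Stable p ω C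

/-- Whatever the batch laws, the non-idling policy and the state space on which the resulting
chain is irreducible, the chain is unstable if the total nat arrival rate is above `t` and the
number of messages is an unbounded function on the state space. -/
def UnstableAbove (t : ℝ) : Prop :=
  ∀ (p : Fin J → PMF ℕ) (ω : Config J → PMF (Schedule J)) (C : Set (Config J)),
    (∀ j, FiniteSecondMoment (p j)) → m.NonIdling ω → C ⊆ m.states →
    MarkovChain.IrreducibleOn (m.chain p ω) C → (∀ b : ℕ, ∃ α ∈ C, b ≤ α.count) →
    t < m.natRate p → m.Unstable p ω C

end Model

/-! Assign to each message a weight that is monotone in its residual requirement and vanishes once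
the message has left, and let V be the total weight. If every full schedule lowers V by at least σ
before arrivals and the arrivals bring mean weight e < σ, then V² has drift about -2(σ-e)V, and
Foster's criterion with cost 1 + const·count gives both positive recurrence and a finite mean number
of messages (`IsWeight.stable`). If full schedules lower V by at most σ < e, then exp(-θV),
truncated from above, is superharmonic and nonconstant for small θ > 0, which excludes recurrence
(`IsWeight.unstable`). The criteria apply because residuals take finitely many values: V is
comparable to the count, and its sublevel sets are finite.

For one class, every full schedule gives the same quantum q. Weighting a message by ⌈x/q⌉, its
number of slots of service, makes the decrease exactly K, so the threshold is K ln M / ⌈S/q⌉; as M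
grows this tends to K q/ρ, and then ρ ↓ 0.

For many classes, a schedule of large total power D gives class j about ρP_j/((1+ρ)D), so the total
service is close to ρ/(1+ρ) whatever the mix (`Positive.service_bounds`). The weights max(x,0) and
x+1 bound the decrease from the two sides; they differ by 1 per message present, which is negligible
against ρ ln M_j, as is -ln p_e. Dividing by ρ gives L(ρ) = 1/(1+ρ). -/

namespace MarkovChain

variable {X : Type*}

/-! ### The chain killed on entering a fixed state, and Foster's criterion -/

section Taboo

variable (P : X → PMF X) (x : X)

open Classical in
/-- The transition kernel of the chain that is killed when it enters `x`. -/
noncomputable def taboo (y z : X) : ℝ≥0∞ := if z = x then 0 else P y z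

/-- The mean of `f` after one step of the killed chain. -/
noncomputable def tabooMean (f : X → ℝ≥0∞) (y : X) : ℝ≥0∞ := ∑' z, taboo P x y z * f z

open Classical in
/-- The law at time `n` of the killed chain started in `x`. -/
noncomputable def tabooLaw : ℕ → X → ℝ≥0∞
  | 0, z => if z = x then 1 else 0
  | n + 1, z => ∑' y, tabooLaw n y * taboo P x y z

/-- The probability that the chain started in `y` avoids `x` at the times `1, …, n`. -/
noncomputable def avoid : ℕ → X → ℝ≥0∞
  | 0, _ => 1
  | n + 1, y => tabooMean P x (avoid n) y

variable {P x}

lemma taboo_le (y z : X) : taboo P x y z ≤ P y z := by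
  unfold taboo; split_ifs <;> simp

lemma tabooMean_mono {f g : X → ℝ≥0∞} {y : X} (h : ∀ z, P y z ≠ 0 → f z ≤ g z) :
    tabooMean P x f y ≤ tabooMean P x g y := by
  refine ENNReal.tsum_le_tsum fun z => ?_
  by_cases hz : P y z = 0
  · simp [le_antisymm ((taboo_le (P := P) (x := x) y z).trans hz.le) zero_le]
  · gcongr; exact h z hz

lemma tabooMean_le (f : X → ℝ≥0∞) (y : X) : tabooMean P x f y ≤ ∑' z, P y z * f z :=
  ENNReal.tsum_le_tsum fun z => by gcongr; exact taboo_le y z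

lemma tsum_mul_eq_add_tabooMean (f : X → ℝ≥0∞) (y : X) :
    ∑' z, P y z * f z = P y x * f x + tabooMean P x f y := by
  classical
  rw [ENNReal.tsum_eq_add_tsum_ite x]
  congr 1
  refine tsum_congr fun z => ?_
  unfold taboo; split_ifs <;> simp

lemma add_tabooMean_one (y : X) : P y x + tabooMean P x (fun _ => 1) y = 1 := by
  have := tsum_mul_eq_add_tabooMean (P := P) (x := x) (fun _ => 1) y
  simpa [(P y).tsum_coe] using this.symm

lemma tabooMean_add (f g : X → ℝ≥0∞) (y : X) :
    tabooMean P x (fun z => f z + g z) y = tabooMean P x f y + tabooMean P x g y := by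
  simp only [tabooMean, mul_add]
  exact ENNReal.tsum_add

lemma tabooMean_const_mul (c : ℝ≥0∞) (f : X → ℝ≥0∞) (y : X) :
    tabooMean P x (fun z => c * f z) y = c * tabooMean P x f y := by
  simp only [tabooMean, ← ENNReal.tsum_mul_left]
  exact tsum_congr fun z => by ring

lemma tabooMean_sum (f : ℕ → X → ℝ≥0∞) (n : ℕ) (y : X) :
    tabooMean P x (fun z => ∑ i ∈ Finset.range n, f i z) y
      = ∑ i ∈ Finset.range n, tabooMean P x (f i) y := by
  induction n with
  | zero => simp [tabooMean]
  | succ n ih => simp only [Finset.sum_range_succ, tabooMean_add, ih]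

lemma firstPassage_succ (n : ℕ) (y : X) :
    firstPassage P x (n + 1) y = tabooMean P x (firstPassage P x n) y := by
  simp only [firstPassage, tabooMean, taboo]
  exact tsum_congr fun z => by split_ifs <;> simp

lemma tabooLaw_succ_mul (n : ℕ) (f : X → ℝ≥0∞) :
    ∑' z, tabooLaw P x (n + 1) z * f z = ∑' y, tabooLaw P x n y * tabooMean P x f y := by
  simp only [tabooLaw, tabooMean, ← ENNReal.tsum_mul_right, ← ENNReal.tsum_mul_left]
  rw [ENNReal.tsum_comm]
  simp only [mul_assoc]

lemma tabooLaw_zero_mul (f : X → ℝ≥0∞) : ∑' z, tabooLaw P x 0 z * f z = f x := by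
  rw [tsum_eq_single x]
  · simp [tabooLaw]
  · intro z hz; simp [tabooLaw, hz]

/-- The Markov property at time n on the event that no return has yet occurred. -/
lemma tsum_tabooLaw_mul_firstPassage (n k : ℕ) :
    ∑' y, tabooLaw P x n y * firstPassage P x k y = firstPassage P x (n + k) x := by
  induction n generalizing k with
  | zero => rw [tabooLaw_zero_mul, zero_add]
  | succ n ih =>
    rw [tabooLaw_succ_mul, Nat.succ_add_eq_add_succ, ← ih (k + 1)]
    simp only [firstPassage_succ]

lemma tsum_tabooLaw_eq (n : ℕ) :
    ∑' y, tabooLaw P x n y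
      = firstPassage P x n x + ∑' y, tabooLaw P x (n + 1) y := by
  have h1 := tsum_tabooLaw_mul_firstPassage (P := P) (x := x) n 0
  have h2 := tabooLaw_succ_mul (P := P) (x := x) n (fun _ => 1)
  simp only [mul_one] at h2
  rw [add_zero] at h1
  rw [← h1, h2, ← ENNReal.tsum_add]
  refine tsum_congr fun y => ?_
  rw [← mul_add]
  simp only [firstPassage, add_tabooMean_one, mul_one]

lemma sum_firstPassage_add (N : ℕ) :
    ∑ n ∈ Finset.range N, firstPassage P x n x + ∑' y, tabooLaw P x N y = 1 := by
  induction N with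
  | zero => simpa using tabooLaw_zero_mul (P := P) (x := x) (fun _ => 1)
  | succ N ih => rw [Finset.sum_range_succ, add_assoc, ← tsum_tabooLaw_eq, ih]

lemma sum_firstPassage_shift_le (n N : ℕ) :
    ∑ k ∈ Finset.range N, firstPassage P x (n + k) x ≤ ∑' y, tabooLaw P x n y := by
  induction N generalizing n with
  | zero => simp
  | succ N ih =>
    rw [Finset.sum_range_succ', tsum_tabooLaw_eq, add_comm]
    refine add_le_add (by simp) ?_
    refine le_trans (le_of_eq ?_) (ih (n + 1))
    exact Finset.sum_congr rfl fun k _ => by rw [Nat.succ_add_eq_add_succ]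

variable (P x) in
/-- The mean number of visits before the first return to `x`. -/
noncomputable def visits (y : X) : ℝ≥0∞ := ∑' n, tabooLaw P x n y

lemma tsum_visits_mul (f : X → ℝ≥0∞) :
    ∑' y, visits P x y * f y = ∑' n, ∑' y, tabooLaw P x n y * f y := by
  simp only [visits, ← ENNReal.tsum_mul_right]
  exact ENNReal.tsum_comm

lemma tsum_visits : ∑' y, visits P x y = ∑' n, ∑' y, tabooLaw P x n y :=
  ENNReal.tsum_comm

/-- The surviving masses are the terms of a convergent series, so they tend to 0, and the mass lost
by time N tends to 1. -/
lemma returnProb_eq_one (h : ∑' y, visits P x y ≠ ⊤) : returnProb P x = 1 := by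
  rw [tsum_visits] at h
  have h0 : Tendsto (fun n => ∑' y, tabooLaw P x n y) atTop (𝓝 0) :=
    ENNReal.tendsto_atTop_zero_of_tsum_ne_top h
  have h1 : Tendsto (fun N => ∑ n ∈ Finset.range N, firstPassage P x n x) atTop
      (𝓝 (returnProb P x)) := ENNReal.tendsto_nat_tsum _
  have h2 := h1.add h0
  simp only [sum_firstPassage_add, add_zero] at h2
  exact tendsto_nhds_unique h2 tendsto_const_nhds

/-- The tail-sum formula for the mean: the surviving mass at time n dominates the probability of a
first return at a finite time after n. -/
lemma meanReturnTime_le : meanReturnTime P x ≤ ∑' y, visits P x y := by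
  have key : ∀ N : ℕ, ∀ g : ℕ → ℝ≥0∞, ∑ n ∈ Finset.range N, ((n : ℝ≥0∞) + 1) * g n
      = ∑ n ∈ Finset.range N, ∑ k ∈ Finset.range (N - n), g (n + k) := by
    intro N
    induction N with
    | zero => simp
    | succ N ih =>
      intro g
      rw [Finset.sum_range_succ, ih, Finset.sum_range_succ]
      have : ∀ n ∈ Finset.range N, ∑ k ∈ Finset.range (N + 1 - n), g (n + k)
          = ∑ k ∈ Finset.range (N - n), g (n + k) + g N := by
        intro n hn
        have hn' := Finset.mem_range.mp hn
        rw [Nat.succ_sub hn'.le, Finset.sum_range_succ, Nat.add_sub_cancel' hn'.le]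
      rw [Finset.sum_congr rfl this, Finset.sum_add_distrib]
      simp
      ring
  rw [meanReturnTime, tsum_visits]
  refine ENNReal.tsum_le_of_sum_range_le fun N => ?_
  rw [key]
  exact (Finset.sum_le_sum fun n _ => sum_firstPassage_shift_le n _).trans
    (ENNReal.sum_le_tsum _)

/-- The cycle formula: occupation counts over one excursion form an invariant measure. Away from x
this is a shift of time; at x the inflow is the return probability, and the only visit counted is
the one at time 0. -/
lemma tsum_visits_mul_apply (h : ∑' y, visits P x y ≠ ⊤) (z : X) :
    ∑' y, visits P x y * P y z = visits P x z := by
  by_cases hz : z = x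
  · subst hz
    have h1 : ∑' y, visits P z y * P y z = 1 := by
      rw [tsum_visits_mul, ← returnProb_eq_one h]
      exact tsum_congr fun n => tsum_tabooLaw_mul_firstPassage n 0
    rw [h1, visits, tsum_eq_single 0]
    · simp [tabooLaw]
    · rintro (_ | n) hn
      · exact absurd rfl hn
      · simp [tabooLaw, taboo]
  · have h0 : tabooLaw P x 0 z = 0 := by simp [tabooLaw, hz]
    rw [tsum_visits_mul, visits, tsum_eq_zero_add' (f := fun n => tabooLaw P x n z)
      ENNReal.summable, h0, zero_add]
    simp [tabooLaw, taboo, hz]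

lemma tabooLaw_eq_zero {C : Set X} (hx : x ∈ C) (hC : ∀ y ∈ C, ∀ z, P y z ≠ 0 → z ∈ C)
    (n : ℕ) : ∀ z ∉ C, tabooLaw P x n z = 0 := by
  induction n with
  | zero =>
    intro z hz
    have : z ≠ x := fun h => hz (h ▸ hx)
    simp [tabooLaw, this]
  | succ n ih =>
    intro z hz
    simp only [tabooLaw, ENNReal.tsum_eq_zero, mul_eq_zero]
    intro y
    by_cases hy : y ∈ C
    · right
      by_contra h
      refine hz (hC y hy z fun h0 => h ?_)
      exact le_antisymm ((taboo_le y z).trans h0.le) zero_le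
    · exact Or.inl (ih y hy)

/-- A function that dominates its own killed mean plus `f` bounds the accumulated cost `f`. -/
lemma tsum_visits_mul_le {C : Set X} (hx : x ∈ C) (hC : ∀ y ∈ C, ∀ z, P y z ≠ 0 → z ∈ C)
    {f W : X → ℝ≥0∞} (h : ∀ y ∈ C, f y + tabooMean P x W y ≤ W y) :
    ∑' y, visits P x y * f y ≤ W x := by
  rw [tsum_visits_mul]
  refine ENNReal.tsum_le_of_sum_range_le fun N => ?_
  have key : ∑ n ∈ Finset.range N, ∑' y, tabooLaw P x n y * f y
      + ∑' y, tabooLaw P x N y * W y ≤ W x := by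
    induction N with
    | zero => simp [tabooLaw_zero_mul]
    | succ N ih =>
      refine le_trans ?_ ih
      rw [Finset.sum_range_succ, add_assoc, tabooLaw_succ_mul, ← ENNReal.tsum_add]
      gcongr with y
      rw [← mul_add]
      by_cases hy : y ∈ C
      · gcongr; exact h y hy
      · simp [tabooLaw_eq_zero hx hC N y hy]
  exact le_self_add.trans key

lemma tabooMean_le_one {f : X → ℝ≥0∞} (hf : ∀ z, f z ≤ 1) (y : X) : tabooMean P x f y ≤ 1 :=
  (tabooMean_mono fun z _ => hf z).trans
    (le_of_le_of_eq le_add_self (add_tabooMean_one (P := P) (x := x) y))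

lemma avoid_le_one (n : ℕ) : ∀ y, avoid P x n y ≤ 1 := by
  induction n with
  | zero => simp [avoid]
  | succ n ih => exact tabooMean_le_one ih

lemma avoid_antitone (y : X) : Antitone fun n => avoid P x n y := by
  have : ∀ n y, avoid P x (n + 1) y ≤ avoid P x n y := by
    intro n
    induction n with
    | zero => intro y; exact avoid_le_one 1 y
    | succ n ih => intro y; exact tabooMean_mono fun z _ => ih z
  exact antitone_nat_of_succ_le fun n => this n y

/-- The partial sum of avoidance probabilities telescopes under the killed kernel: its mean drops by
1 - `avoid P x n y`. This bounded function later absorbs the positive drift on the finite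
exceptional set. -/
lemma tabooMean_sum_avoid (n : ℕ) (y : X) :
    tabooMean P x (fun z => ∑ i ∈ Finset.range n, avoid P x i z) y + 1
      = ∑ i ∈ Finset.range n, avoid P x i y + avoid P x n y := by
  rw [tabooMean_sum, ← Finset.sum_range_succ, Finset.sum_range_succ']
  simp [avoid]

lemma avoid_succ_lt_one {n : ℕ} {y z : X} (hyz : P y z ≠ 0)
    (h : z = x ∨ avoid P x n z < 1) : avoid P x (n + 1) y < 1 := by
  have h1 : ∑' w, P y w = 1 := (P y).tsum_coe
  rw [← h1]
  have hle : ∀ w, taboo P x y w * avoid P x n w ≤ P y w := fun w =>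
    (mul_le_mul' (taboo_le y w) (avoid_le_one n w)).trans (mul_one _).le
  refine ENNReal.tsum_lt_tsum (i := z) ?_ hle ?_
  · exact ne_top_of_le_ne_top (by simp [h1]) (ENNReal.tsum_le_tsum hle)
  · rcases h with rfl | h
    · simpa [taboo] using pos_iff_ne_zero.mpr hyz
    · calc taboo P x y z * avoid P x n z ≤ P y z * avoid P x n z := by
            gcongr; exact taboo_le y z
        _ < P y z * 1 := by
            exact (ENNReal.mul_lt_mul_iff_right hyz ((P y).apply_ne_top z)).mpr h
        _ = P y z := mul_one _

lemma IrreducibleOn.exists_avoid_lt_one {C : Set X} (hC : IrreducibleOn P C) (hx : x ∈ C)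
    {y : X} (hy : y ∈ C) : ∃ n, avoid P x n y < 1 := by
  have key : ∀ z, Relation.ReflTransGen (fun a b => P a b ≠ 0) z x →
      z = x ∨ ∃ n, avoid P x n z < 1 := by
    intro z hz
    induction hz using Relation.ReflTransGen.head_induction_on with
    | refl => exact Or.inl rfl
    | head hab _ ih =>
      right
      rcases ih with h | ⟨n, h⟩
      · exact ⟨1, avoid_succ_lt_one hab (Or.inl h)⟩
      · exact ⟨n + 1, avoid_succ_lt_one hab (Or.inr h)⟩
  -- The start y may be x itself, and avoidance only counts times from 1 on, so one step is taken
  -- before following a path to x.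
  obtain ⟨z, hz⟩ := (P y).support_nonempty
  have hz' : P y z ≠ 0 := (PMF.mem_support_iff _ _).mp hz
  rcases key z (hC.communicate z (hC.closed y hy z hz') x hx) with h | ⟨n, h⟩
  · exact ⟨1, avoid_succ_lt_one hz' (Or.inl h)⟩
  · exact ⟨n + 1, avoid_succ_lt_one hz' (Or.inr h)⟩

/-- The Foster–Lyapunov bound on the cost accumulated between two visits to `x`. -/
lemma IrreducibleOn.tsum_visits_mul_ne_top {C : Set X} (hC : IrreducibleOn P C) (hx : x ∈ C)
    {F : Set X} (hF : F.Finite) (hFC : F ⊆ C) {f W : X → ℝ≥0∞} (hW : ∀ y ∈ C, W y ≠ ⊤)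
    (hf : ∀ y ∈ F, f y + ∑' z, P y z * W z ≠ ⊤)
    (hdrift : ∀ y ∈ C, y ∉ F → f y + ∑' z, P y z * W z ≤ W y) :
    ∑' y, visits P x y * f y ≠ ⊤ := by
  classical
  -- One horizon serves all of the finite set F, since avoidance decreases with time.
  have h1 : ∃ n, ∀ y ∈ F, avoid P x n y < 1 := by
    choose! k hk using fun y (hy : y ∈ C) => hC.exists_avoid_lt_one hx hy
    refine ⟨hF.toFinset.sup k, fun y hy => ?_⟩
    exact lt_of_le_of_lt
      (avoid_antitone y (Finset.le_sup (f := k) (hF.mem_toFinset.mpr hy))) (hk y (hFC hy))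
  obtain ⟨n, hn⟩ := h1
  have h2 : ∃ κ : ℝ≥0∞, κ ≠ ⊤ ∧ ∀ y ∈ F,
      f y + ∑' z, P y z * W z ≤ κ * (1 - avoid P x n y) := by
    refine ⟨∑ y ∈ hF.toFinset, (f y + ∑' z, P y z * W z) / (1 - avoid P x n y), ?_, ?_⟩
    · refine ENNReal.sum_ne_top.mpr fun y hy => ?_
      have hy' := hF.mem_toFinset.mp hy
      exact ENNReal.div_ne_top (hf y hy') (tsub_pos_of_lt (hn y hy')).ne'
    · intro y hy
      rw [← ENNReal.div_le_iff (tsub_pos_of_lt (hn y hy)).ne'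
        (ne_top_of_le_ne_top ENNReal.one_ne_top tsub_le_self)]
      exact Finset.single_le_sum
        (f := fun y => (f y + ∑' z, P y z * W z) / (1 - avoid P x n y))
        (fun _ _ => zero_le) (hF.mem_toFinset.mpr hy)
  obtain ⟨κ, hκ, hκF⟩ := h2
  set U : X → ℝ≥0∞ := fun y => ∑ i ∈ Finset.range n, avoid P x i y with hU
  have hUn : ∀ y, U y ≤ n := fun y => by
    refine (Finset.sum_le_sum fun i _ => avoid_le_one i y).trans ?_
    simp
  have hUstep : ∀ y, (1 - avoid P x n y) + tabooMean P x U y ≤ U y := by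
    intro y
    have h3 := tabooMean_sum_avoid (P := P) (x := x) n y
    have h4 : avoid P x n y ≠ ⊤ := ne_top_of_le_ne_top ENNReal.one_ne_top (avoid_le_one n y)
    refine (ENNReal.add_le_add_iff_right h4).mp ?_
    rw [← h3, add_right_comm, tsub_add_cancel_of_le (avoid_le_one n y), add_comm]
  -- The corrected Lyapunov function: on F the drop of κU pays for the cost and the whole mean of W;
  -- off F the drift of W suffices and κU does not increase.
  refine ne_top_of_le_ne_top ?_ (tsum_visits_mul_le (W := fun y => W y + κ * U y) hx hC.closed ?_)
  · exact ENNReal.add_ne_top.mpr ⟨hW x hx,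
      ENNReal.mul_ne_top hκ (ne_top_of_le_ne_top (ENNReal.natCast_ne_top n) (hUn x))⟩
  · intro y hy
    rw [tabooMean_add, tabooMean_const_mul, ← add_assoc]
    have h5 : f y + tabooMean P x W y ≤ f y + ∑' z, P y z * W z := by
      gcongr; exact tabooMean_le W y
    by_cases hyF : y ∈ F
    · calc f y + tabooMean P x W y + κ * tabooMean P x U y
          ≤ κ * (1 - avoid P x n y) + κ * tabooMean P x U y := by
            gcongr; exact h5.trans (hκF y hyF)
        _ ≤ κ * U y := by rw [← mul_add]; gcongr; exact hUstep y
        _ ≤ W y + κ * U y := le_add_self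
    · gcongr
      · exact h5.trans (hdrift y hy hyF)
      · exact le_add_self.trans (hUstep y)

end Taboo

/-- The Foster–Lyapunov criterion for positive recurrence, with a bound on the stationary mean of
the cost `f`. -/
theorem IrreducibleOn.positiveRecurrentOn {P : X → PMF X} {C : Set X} (hC : IrreducibleOn P C)
    {F : Set X} (hF : F.Finite) (hFC : F ⊆ C) {f W : X → ℝ≥0∞} (hf1 : ∀ y, 1 ≤ f y)
    (hW : ∀ y ∈ C, W y ≠ ⊤) (hf : ∀ y ∈ F, f y + ∑' z, P y z * W z ≠ ⊤)
    (hdrift : ∀ y ∈ C, y ∉ F → f y + ∑' z, P y z * W z ≤ W y) :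
    PositiveRecurrentOn P C ∧ ∃ μ : PMF X, StationaryOn P C μ ∧ ∑' y, μ y * f y ≠ ⊤ := by
  have hcost : ∀ x ∈ C, ∑' y, visits P x y * f y ≠ ⊤ := fun x hx =>
    hC.tsum_visits_mul_ne_top hx hF hFC hW hf hdrift
  have hfin : ∀ x ∈ C, ∑' y, visits P x y ≠ ⊤ := fun x hx =>
    ne_top_of_le_ne_top (hcost x hx)
      (ENNReal.tsum_le_tsum fun y => le_mul_of_one_le_right' (hf1 y))
  refine ⟨fun x hx => ⟨returnProb_eq_one (hfin x hx),
    ne_top_of_le_ne_top (hfin x hx) meanReturnTime_le⟩, ?_⟩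
  obtain ⟨x, hx⟩ := hC.nonempty
  have hne : ∑' y, visits P x y ≠ 0 := by
    intro h
    have h1 : tabooLaw P x 0 x ≤ 0 := by
      rw [← ENNReal.tsum_eq_zero.mp h x]
      exact ENNReal.le_tsum 0
    simp [tabooLaw] at h1
  have happ : ∀ y, PMF.normalize (visits P x) hne (hfin x hx) y
      = visits P x y * (∑' y, visits P x y)⁻¹ := fun y => PMF.normalize_apply _ _ _
  refine ⟨PMF.normalize (visits P x) hne (hfin x hx), ⟨?_, ?_⟩, ?_⟩
  · intro y hy
    by_contra hyC
    rw [PMF.mem_support_normalize_iff] at hy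
    refine hy ?_
    simp [visits, tabooLaw_eq_zero hx hC.closed _ y hyC]
  · ext z
    rw [PMF.bind_apply]
    simp only [happ]
    simp only [mul_right_comm _ (∑' y, visits P x y)⁻¹]
    rw [ENNReal.tsum_mul_right, tsum_visits_mul_apply (hfin x hx)]
  · simp only [happ]
    simp only [mul_right_comm _ (∑' y, visits P x y)⁻¹]
    rw [ENNReal.tsum_mul_right]
    exact ENNReal.mul_ne_top (hcost x hx) (ENNReal.inv_ne_top.mpr hne)

/-! ### Hitting probabilities and a criterion for transience -/

lemma sum_firstPassage_succ (P : X → PMF X) (x : X) (N : ℕ) (y : X) :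
    ∑ n ∈ Finset.range (N + 1), firstPassage P x n y
      = P y x + tabooMean P x (fun z => ∑ n ∈ Finset.range N, firstPassage P x n z) y := by
  rw [Finset.sum_range_succ', tabooMean_sum, add_comm]
  simp only [firstPassage_succ]
  rfl

lemma tsum_firstPassage (P : X → PMF X) (x y : X) :
    ∑' n, firstPassage P x n y
      = P y x + tabooMean P x (fun z => ∑' n, firstPassage P x n z) y := by
  rw [tsum_eq_zero_add' ENNReal.summable]
  simp only [firstPassage_succ, tabooMean, ← ENNReal.tsum_mul_left]
  rw [ENNReal.tsum_comm]
  rfl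

lemma tsum_firstPassage_le_one (P : X → PMF X) (x y : X) :
    ∑' n, firstPassage P x n y ≤ 1 := by
  refine ENNReal.tsum_le_of_sum_range_le fun N => ?_
  induction N generalizing y with
  | zero => simp
  | succ N ih =>
    rw [sum_firstPassage_succ, ← add_tabooMean_one (P := P) (x := x) y]
    gcongr
    exact tabooMean_mono fun z _ => ih z

/-- On a chain that is not transient, a bounded superharmonic function is constant. -/
theorem IrreducibleOn.transientOn {P : X → PMF X} {C : Set X} (hC : IrreducibleOn P C)
    {g : X → ℝ≥0∞} (hg : ∀ y ∈ C, g y ≠ ⊤) (hsup : ∀ y ∈ C, ∑' z, P y z * g z ≤ g y)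
    {a b : X} (ha : a ∈ C) (hb : b ∈ C) (hab : g a ≠ g b) : TransientOn P C := by
  intro x hx
  by_contra hret
  have hx1 : ∑' n, firstPassage P x n x = 1 :=
    le_antisymm (tsum_firstPassage_le_one P x x) (not_lt.mp hret)
  -- Certainty of hitting x propagates along positive transitions: a successor that could miss x
  -- would make its predecessor miss x with positive probability.
  have hone : ∀ y ∈ C, ∑' n, firstPassage P x n y = 1 := by
    intro y hy
    have hpath := hC.communicate x hx y hy
    clear hy
    induction hpath with
    | refl => exact hx1
    | @tail y z _ hyz ih =>
      by_contra hz
      have hzx : z ≠ x := fun h => hz (h ▸ hx1)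
      have hlt : ∑' n, firstPassage P x n z < 1 :=
        lt_of_le_of_ne (tsum_firstPassage_le_one P x z) hz
      rw [tsum_firstPassage, ← add_tabooMean_one (P := P) (x := x) y] at ih
      have h1 : tabooMean P x (fun z => ∑' n, firstPassage P x n z) y
          = tabooMean P x (fun _ => 1) y :=
        (ENNReal.add_right_inj ((P y).apply_ne_top x)).mp ih
      refine absurd h1 (ne_of_lt ?_)
      refine ENNReal.tsum_lt_tsum (i := z) ?_
        (fun w => by gcongr; exact tsum_firstPassage_le_one P x w) ?_
      · exact ne_top_of_le_ne_top ENNReal.one_ne_top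
          (tabooMean_le_one (tsum_firstPassage_le_one P x) y)
      · simp only [taboo, hzx, if_false]
        exact (ENNReal.mul_lt_mul_iff_right hyz ((P y).apply_ne_top z)).mpr hlt
  -- Optional stopping at the hitting time of x, truncated at N: g y is at least the probability of
  -- hitting by time N, times g x.
  have hmin : ∀ y ∈ C, g x ≤ g y := by
    have hN : ∀ N : ℕ, ∀ y ∈ C, (∑ n ∈ Finset.range N, firstPassage P x n y) * g x ≤ g y := by
      intro N
      induction N with
      | zero => simp
      | succ N ih =>
        intro y hy
        refine le_trans ?_ (hsup y hy)
        rw [sum_firstPassage_succ, add_mul, tsum_mul_eq_add_tabooMean (x := x) g y, mul_comm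
          (tabooMean P x _ y), ← tabooMean_const_mul]
        gcongr
        exact tabooMean_mono fun z hz => by
          rw [mul_comm]; exact ih z (hC.closed y hy z hz)
    intro y hy
    have h1 := hone y hy
    have h2 : (∑' n, firstPassage P x n y) * g x ≤ g y := by
      rw [← ENNReal.tsum_mul_right]
      refine ENNReal.tsum_le_of_sum_range_le fun N => ?_
      rw [← Finset.sum_mul]
      exact hN N y hy
    rwa [h1, one_mul] at h2
  -- The minimum principle: a successor with a larger value would push the mean above the minimum,
  -- against superharmonicity.
  have hconst : ∀ y, Relation.ReflTransGen (fun a b => P a b ≠ 0) x y → y ∈ C ∧ g y = g x := by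
    intro y hpath
    induction hpath with
    | refl => exact ⟨hx, rfl⟩
    | @tail y z _ hyz ih =>
      obtain ⟨hy, hyx⟩ := ih
      have hz := hC.closed y hy z hyz
      refine ⟨hz, ?_⟩
      by_contra hne
      have hlt : g x < g z := lt_of_le_of_ne (hmin z hz) (Ne.symm hne)
      have h1 : ∑' w, P y w * g x = g x := by
        rw [ENNReal.tsum_mul_right, (P y).tsum_coe, one_mul]
      have h2 : ∑' w, P y w * g x < ∑' w, P y w * g w := by
        refine ENNReal.tsum_lt_tsum (i := z) (by rw [h1]; exact hg x hx) (fun w => ?_) ?_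
        · by_cases hw : P y w = 0
          · simp [hw]
          · gcongr; exact hmin w (hC.closed y hy w hw)
        · exact (ENNReal.mul_lt_mul_iff_right hyz ((P y).apply_ne_top z)).mpr hlt
      rw [h1] at h2
      exact absurd (h2.trans_le (hsup y hy)) (by rw [hyx]; exact lt_irrefl _)
  exact hab ((hconst a (hC.communicate x hx a ha)).2.trans
    (hconst b (hC.communicate x hx b hb)).2.symm)

end MarkovChain

/-! ### Means under composed laws -/

namespace PMF

variable {A B : Type*}

lemma tsum_bind_mul (p : PMF A) (f : A → PMF B) (g : B → ℝ≥0∞) :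
    ∑' b, p.bind f b * g b = ∑' a, p a * ∑' b, f a b * g b := by
  simp only [bind_apply, ← ENNReal.tsum_mul_right, ← ENNReal.tsum_mul_left]
  rw [ENNReal.tsum_comm]
  simp only [mul_assoc]

lemma tsum_map_mul (p : PMF A) (f : A → B) (g : B → ℝ≥0∞) :
    ∑' b, p.map f b * g b = ∑' a, p a * g (f a) := by
  rw [← bind_pure_comp, tsum_bind_mul]
  refine tsum_congr fun a => ?_
  rw [tsum_eq_single (f a)]
  · simp
  · intro b hb; simp [hb]

lemma tsum_mul_le (p : PMF A) {g : A → ℝ≥0∞} {c : ℝ≥0∞} (h : ∀ a, p a ≠ 0 → g a ≤ c) :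
    ∑' a, p a * g a ≤ c := by
  calc ∑' a, p a * g a ≤ ∑' a, p a * c := by
        refine ENNReal.tsum_le_tsum fun a => ?_
        by_cases ha : p a = 0
        · simp [ha]
        · gcongr; exact h a ha
    _ = c := by rw [ENNReal.tsum_mul_right, p.tsum_coe, one_mul]

end PMF

/-! ### Moments of the batch sizes -/

section Batch

variable {J : ℕ} {p : Fin J → PMF ℕ}

lemma batchLaw_map_eval (p : Fin J → PMF ℕ) (j : Fin J) :
    (batchLaw p).map (fun a => a j) = p j := by
  apply PMF.toMeasure_injective
  rw [← PMF.toMeasure_map (fun a : Fin J → ℕ => a j) _ (measurable_pi_apply j), batchLaw, MeasureTheory.Measure.toPMF_toMeasure]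
  exact (MeasureTheory.measurePreserving_eval (fun j => (p j).toMeasure) j).map_eq

lemma tsum_batchLaw_mul_eval (p : Fin J → PMF ℕ) (j : Fin J) (g : ℕ → ℝ≥0∞) :
    ∑' a, batchLaw p a * g (a j) = ∑' k, p j k * g k := by
  rw [← PMF.tsum_map_mul (batchLaw p) (fun a => a j) g, batchLaw_map_eval]

lemma FiniteSecondMoment.mean_ne_top {q : PMF ℕ} (h : FiniteSecondMoment q) :
    ∑' k : ℕ, (k : ℝ≥0∞) * q k ≠ ⊤ := by
  refine ne_top_of_le_ne_top h (ENNReal.tsum_le_tsum fun k => ?_)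
  gcongr
  exact_mod_cast Nat.le_self_pow two_ne_zero k

lemma meanBatch_nonneg (q : PMF ℕ) : 0 ≤ meanBatch q := ENNReal.toReal_nonneg

/-- The work brought by a vector of batches, when a class-`j` message brings work `w j`. -/
noncomputable def batchWork (w : Fin J → ℝ) (a : Fin J → ℕ) : ℝ := ∑ j, (a j : ℝ) * w j

variable {w : Fin J → ℝ}

lemma batchWork_nonneg (hw : ∀ j, 0 ≤ w j) (a : Fin J → ℕ) : 0 ≤ batchWork w a :=
  Finset.sum_nonneg fun j _ => mul_nonneg (Nat.cast_nonneg _) (hw j)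

lemma tsum_batchLaw_mul_batchWork (hp : ∀ j, FiniteSecondMoment (p j)) (hw : ∀ j, 0 ≤ w j) :
    ∑' a, batchLaw p a * ENNReal.ofReal (batchWork w a)
      = ENNReal.ofReal (∑ j, meanBatch (p j) * w j) := by
  have h1 : ∀ a : Fin J → ℕ, batchLaw p a * ENNReal.ofReal (batchWork w a)
      = ∑ j, batchLaw p a * ((a j : ℝ≥0∞) * ENNReal.ofReal (w j)) := by
    intro a
    rw [batchWork, ENNReal.ofReal_sum_of_nonneg
      fun j _ => mul_nonneg (Nat.cast_nonneg _) (hw j), Finset.mul_sum]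
    refine Finset.sum_congr rfl fun j _ => ?_
    rw [ENNReal.ofReal_mul (Nat.cast_nonneg _), ENNReal.ofReal_natCast]
  simp only [h1]
  rw [Summable.tsum_finsetSum fun _ _ => ENNReal.summable,
    ENNReal.ofReal_sum_of_nonneg fun j _ => mul_nonneg (meanBatch_nonneg _) (hw j)]
  refine Finset.sum_congr rfl fun j _ => ?_
  rw [tsum_batchLaw_mul_eval p j (fun k => (k : ℝ≥0∞) * ENNReal.ofReal (w j)),
    ENNReal.ofReal_mul (meanBatch_nonneg _), meanBatch,
    ENNReal.ofReal_toReal (hp j).mean_ne_top, ← ENNReal.tsum_mul_right]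
  exact tsum_congr fun k => by ring

/-- Cauchy–Schwarz over the classes reduces the square to the marginal second moments. -/
lemma tsum_batchLaw_mul_batchWork_sq_ne_top (hp : ∀ j, FiniteSecondMoment (p j)) :
    ∑' a, batchLaw p a * ENNReal.ofReal (batchWork w a ^ 2) ≠ ⊤ := by
  have h1 : ∀ a : Fin J → ℕ, batchLaw p a * ENNReal.ofReal (batchWork w a ^ 2)
      ≤ ∑ j, batchLaw p a * ((a j : ℝ≥0∞) ^ 2 * ENNReal.ofReal (J * w j ^ 2)) := by
    intro a
    rw [← Finset.mul_sum]
    gcongr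
    have h2 : batchWork w a ^ 2 ≤ ∑ j, (a j : ℝ) ^ 2 * (J * w j ^ 2) := by
      have := sq_sum_le_card_mul_sum_sq (s := Finset.univ) (f := fun j => (a j : ℝ) * w j)
      simp only [Finset.card_univ, Fintype.card_fin, Finset.mul_sum] at this
      refine this.trans (le_of_eq (Finset.sum_congr rfl fun j _ => by ring))
    refine (ENNReal.ofReal_le_ofReal h2).trans (le_of_eq ?_)
    rw [ENNReal.ofReal_sum_of_nonneg fun j _ => by positivity]
    refine Finset.sum_congr rfl fun j _ => ?_
    rw [ENNReal.ofReal_mul (by positivity), ENNReal.ofReal_pow (by positivity),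
      ENNReal.ofReal_natCast]
  refine ne_top_of_le_ne_top ?_ (ENNReal.tsum_le_tsum h1)
  rw [Summable.tsum_finsetSum fun _ _ => ENNReal.summable]
  refine ENNReal.sum_ne_top.mpr fun j _ => ?_
  rw [tsum_batchLaw_mul_eval p j (fun k => (k : ℝ≥0∞) ^ 2 * ENNReal.ofReal (J * w j ^ 2))]
  have h3 : ∑' k : ℕ, p j k * ((k : ℝ≥0∞) ^ 2 * ENNReal.ofReal (J * w j ^ 2))
      = (∑' k : ℕ, (k : ℝ≥0∞) ^ 2 * p j k) * ENNReal.ofReal (J * w j ^ 2) := by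
    rw [← ENNReal.tsum_mul_right]
    exact tsum_congr fun k => by ring
  rw [h3]
  exact ENNReal.mul_ne_top (hp j) ENNReal.ofReal_ne_top

/-- The mean of the square of the work brought by the arrivals of one slot. -/
noncomputable def meanSqWork (p : Fin J → PMF ℕ) (w : Fin J → ℝ) : ℝ :=
  (∑' a, batchLaw p a * ENNReal.ofReal (batchWork w a ^ 2)).toReal

lemma meanSqWork_nonneg : 0 ≤ meanSqWork p w := ENNReal.toReal_nonneg

lemma tsum_batchLaw_mul_quadratic (hp : ∀ j, FiniteSecondMoment (p j)) (hw : ∀ j, 0 ≤ w j)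
    {x y z : ℝ} (hx : 0 ≤ x) (hy : 0 ≤ y) (hz : 0 ≤ z) :
    ∑' a, batchLaw p a * ENNReal.ofReal (x + y * batchWork w a + z * batchWork w a ^ 2)
      = ENNReal.ofReal (x + y * (∑ j, meanBatch (p j) * w j) + z * meanSqWork p w) := by
  have hY := batchWork_nonneg hw
  have hm : 0 ≤ ∑ j, meanBatch (p j) * w j :=
    Finset.sum_nonneg fun j _ => mul_nonneg (meanBatch_nonneg _) (hw j)
  have h1 : ∀ a, batchLaw p a * ENNReal.ofReal (x + y * batchWork w a + z * batchWork w a ^ 2)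
      = batchLaw p a * ENNReal.ofReal x
        + ENNReal.ofReal y * (batchLaw p a * ENNReal.ofReal (batchWork w a))
        + ENNReal.ofReal z * (batchLaw p a * ENNReal.ofReal (batchWork w a ^ 2)) := by
    intro a
    have := hY a
    rw [ENNReal.ofReal_add (by positivity) (by positivity),
      ENNReal.ofReal_add (by positivity) (by positivity), ENNReal.ofReal_mul hy,
      ENNReal.ofReal_mul hz]
    ring
  simp only [h1]
  rw [ENNReal.tsum_add, ENNReal.tsum_add, ENNReal.tsum_mul_right, ENNReal.tsum_mul_left,
    ENNReal.tsum_mul_left, PMF.tsum_coe, one_mul, tsum_batchLaw_mul_batchWork hp hw,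
    ← ENNReal.ofReal_toReal (tsum_batchLaw_mul_batchWork_sq_ne_top hp (w := w))]
  have h2 := meanSqWork_nonneg (p := p) (w := w)
  rw [ENNReal.ofReal_add (by positivity) (by positivity),
    ENNReal.ofReal_add (by positivity) (by positivity), ENNReal.ofReal_mul hy,
    ENNReal.ofReal_mul hz, meanSqWork]

lemma exp_neg_add_le {t : ℝ} (ht : -1 ≤ t) : Real.exp (-t) + t ≤ 1 + t ^ 2 := by
  rcases le_or_gt t 1 with h | h
  · have := Real.abs_exp_sub_one_sub_id_le (x := -t) (by rw [abs_neg, abs_le]; exact ⟨ht, h⟩)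
    have := (abs_le.mp this).2
    linarith [neg_sq t]
  · have : Real.exp (-t) ≤ 1 := Real.exp_le_one_iff.mpr (by linarith)
    nlinarith

/-- If the mean work of a slot exceeds `σ`, the exponential moment of `σ` minus this work is at
most `1` for a small exponent. -/
lemma exists_tsum_batchLaw_mul_exp_le (hp : ∀ j, FiniteSecondMoment (p j)) (hw : ∀ j, 0 ≤ w j)
    {σ : ℝ} (hσ : 0 ≤ σ) (hload : σ < ∑ j, meanBatch (p j) * w j) :
    ∃ θ : ℝ, 0 < θ ∧
      ∑' a, batchLaw p a * ENNReal.ofReal (Real.exp (-(θ * (batchWork w a - σ)))) ≤ 1 := by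
  set e := ∑ j, meanBatch (p j) * w j with he
  set B := meanSqWork p w with hB
  have hB0 : 0 ≤ B := meanSqWork_nonneg
  have he0 : 0 < e := hσ.trans_lt hload
  -- The first bound keeps θ(work - σ) ≥ -1, as `exp_neg_add_le` requires; the second makes the
  -- quadratic error at most the linear gain θ(e - σ).
  obtain ⟨θ, hθ, hθ1, hθ2⟩ : ∃ θ : ℝ, 0 < θ ∧ θ * σ ≤ 1 ∧ θ * (σ ^ 2 + B) ≤ e - σ := by
    refine ⟨min (1 / (σ + 1)) ((e - σ) / (σ ^ 2 + B + 1)), ?_, ?_, ?_⟩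
    · exact lt_min (by positivity) (div_pos (by linarith) (by positivity))
    · refine (mul_le_mul_of_nonneg_right (min_le_left _ _) hσ).trans ?_
      rw [one_div_mul_eq_div, div_le_one (by positivity)]; linarith
    · refine (mul_le_mul_of_nonneg_right (min_le_right _ _) (by positivity)).trans ?_
      rw [div_mul_eq_mul_div, div_le_iff₀ (by positivity)]
      nlinarith [sq_nonneg σ]
  refine ⟨θ, hθ, ?_⟩
  -- The negative linear term is moved to the left, so that all means are of nonnegative quantities;
  -- it is cancelled at the end.
  have h1 : ∀ a, ENNReal.ofReal (Real.exp (-(θ * (batchWork w a - σ))))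
      + ENNReal.ofReal (0 + θ * batchWork w a + 0 * batchWork w a ^ 2)
      ≤ ENNReal.ofReal (1 + θ * σ + θ ^ 2 * σ ^ 2 + 0 * batchWork w a
        + θ ^ 2 * batchWork w a ^ 2) := by
    intro a
    have hY := batchWork_nonneg hw a
    rw [← ENNReal.ofReal_add (Real.exp_pos _).le (by positivity)]
    refine ENNReal.ofReal_le_ofReal ?_
    have h2 := exp_neg_add_le (t := θ * (batchWork w a - σ)) (by nlinarith)
    have h3 : 0 ≤ θ ^ 2 * (σ * batchWork w a) := by positivity
    nlinarith
  have h4 : ∑' a, batchLaw p a * ENNReal.ofReal (Real.exp (-(θ * (batchWork w a - σ))))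
      + ENNReal.ofReal (θ * e) ≤ 1 + ENNReal.ofReal (θ * e) := by
    calc _ = ∑' a, batchLaw p a * (ENNReal.ofReal (Real.exp (-(θ * (batchWork w a - σ))))
            + ENNReal.ofReal (0 + θ * batchWork w a + 0 * batchWork w a ^ 2)) := by
          simp only [mul_add]
          rw [ENNReal.tsum_add, tsum_batchLaw_mul_quadratic hp hw le_rfl hθ.le le_rfl]
          simp [he]
      _ ≤ _ := ENNReal.tsum_le_tsum fun a => mul_le_mul_right (h1 a) _
      _ = ENNReal.ofReal (1 + θ * σ + θ ^ 2 * σ ^ 2 + 0 * e + θ ^ 2 * B) :=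
          tsum_batchLaw_mul_quadratic hp hw (by positivity) le_rfl (by positivity)
      _ ≤ ENNReal.ofReal (1 + θ * e) := by
          refine ENNReal.ofReal_le_ofReal ?_
          nlinarith
      _ = 1 + ENNReal.ofReal (θ * e) := by
          rw [ENNReal.ofReal_add zero_le_one (by positivity), ENNReal.ofReal_one]
  exact (ENNReal.add_le_add_iff_right ENNReal.ofReal_ne_top).mp h4

end Batch

/-! ### Residual service requirements -/

/-- Values are counted, not multipliers: a zero quantum admits infinitely many multipliers but
contributes only the value 0. -/
lemma finite_natCast_mul_le (q c : ℝ) (hq : 0 ≤ q) :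
    {y : ℝ | ∃ k : ℕ, y = k * q ∧ y ≤ c}.Finite := by
  rcases hq.eq_or_lt with rfl | hq
  · refine (Set.finite_singleton 0).subset ?_
    rintro y ⟨k, rfl, _⟩
    simp
  · refine ((Finset.range (⌊c / q⌋₊ + 1)).image fun k : ℕ => (k : ℝ) * q).finite_toSet.subset ?_
    rintro y ⟨k, rfl, hk⟩
    simp only [Finset.coe_image, Finset.coe_range, Set.mem_image, Set.mem_Iio]
    exact ⟨k, Nat.lt_succ_of_le (Nat.le_floor ((le_div_iff₀ hq).mpr hk)), rfl⟩

lemma finite_sum_natCast_mul_le {ι : Type*} (A : Finset ι) (q : ι → ℝ) (c : ℝ)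
    (hq : ∀ i, 0 ≤ q i) : {y : ℝ | ∃ d : ι → ℕ, y = ∑ i ∈ A, d i * q i ∧ y ≤ c}.Finite := by
  classical
  induction A using Finset.induction_on with
  | empty =>
    refine (Set.finite_singleton 0).subset ?_
    rintro y ⟨d, rfl, _⟩
    simp
  | insert i A hi ih =>
    refine ((finite_natCast_mul_le (q i) c (hq i)).image2 (· + ·) ih).subset ?_
    rintro y ⟨d, rfl, hy⟩
    rw [Finset.sum_insert hi] at hy ⊢
    have h1 : 0 ≤ (d i : ℝ) * q i := mul_nonneg (Nat.cast_nonneg _) (hq i)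
    have h2 : 0 ≤ ∑ k ∈ A, (d k : ℝ) * q k :=
      Finset.sum_nonneg fun k _ => mul_nonneg (Nat.cast_nonneg _) (hq k)
    exact ⟨_, ⟨d i, rfl, by linarith⟩, _, ⟨d, rfl, by linarith⟩, rfl⟩

lemma List.sum_map_add_le {A : Type*} {f g : A → ℝ} {r : ℝ} (l : List A)
    (h : ∀ x ∈ l, g x + r ≤ f x) : (l.map g).sum + l.length * r ≤ (l.map f).sum := by
  induction l with
  | nil => simp
  | cons x l ih =>
    have h1 := h x (by simp)
    have h2 := ih fun y hy => h y (by simp [hy])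
    simp only [List.map_cons, List.sum_cons, List.length_cons]
    push_cast
    linarith

namespace Model

variable {J : ℕ} (m : Model J)

/-- The parameters that determine the quanta are positive. -/
structure Positive : Prop where
  ρ : 0 < m.ρ
  noise : 0 < m.noise
  power : ∀ j, 0 < m.power j

/-- The possible residual requirements of a class-`j` message. -/
def residuals (j : Fin J) : Set ℝ :=
  {x | 0 < x ∧ ∃ d : Schedule J → ℕ,
    x = m.requirement j - ∑ s ∈ m.schedules, (d s : ℝ) * m.quantum s j}

variable {m}

lemma Positive.power_le (hm : m.Positive) {s : Schedule J} {j : Fin J} (h : s j ≠ 0) :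
    m.power j ≤ ∑ k, (s k : ℝ) * m.power k := by
  have h1 : (s j : ℝ) * m.power j ≤ ∑ k, (s k : ℝ) * m.power k :=
    Finset.single_le_sum (f := fun k => (s k : ℝ) * m.power k)
      (fun k _ => mul_nonneg (Nat.cast_nonneg _) (hm.power k).le) (Finset.mem_univ j)
  have h2 : (1 : ℝ) ≤ s j := by exact_mod_cast Nat.one_le_iff_ne_zero.mpr h
  nlinarith [hm.power j]

lemma Positive.quantum_nonneg (hm : m.Positive) (s : Schedule J) (j : Fin J) :
    0 ≤ m.quantum s j := by
  unfold quantum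
  split_ifs with h
  · exact le_rfl
  · have := hm.power_le h
    have := hm.ρ
    have := hm.noise
    refine mul_nonneg hm.ρ.le (Real.log_nonneg ?_)
    have : 0 ≤ m.power j / ((1 + m.ρ) * ((∑ k, (s k : ℝ) * m.power k) - m.power j + m.noise)) :=
      div_nonneg (hm.power j).le (mul_nonneg (by linarith) (by linarith))
    linarith

lemma Positive.le_requirement (hm : m.Positive) {j : Fin J} {x : ℝ} (hx : x ∈ m.residuals j) :
    x ≤ m.requirement j := by
  obtain ⟨_, d, rfl⟩ := hx
  have : 0 ≤ ∑ s ∈ m.schedules, (d s : ℝ) * m.quantum s j :=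
    Finset.sum_nonneg fun s _ => mul_nonneg (Nat.cast_nonneg _) (hm.quantum_nonneg s j)
  linarith

/-- A positive residual means that the service received is below the requirement, and only finitely
many sums of nonnegative quanta lie there. -/
lemma Positive.finite_residuals (hm : m.Positive) (j : Fin J) : (m.residuals j).Finite := by
  refine ((finite_sum_natCast_mul_le m.schedules (fun s => m.quantum s j) (m.requirement j)
    (fun s => hm.quantum_nonneg s j)).image fun y => m.requirement j - y).subset ?_
  rintro x ⟨hx, d, hd⟩
  exact ⟨_, ⟨d, rfl, by linarith⟩, hd.symm⟩

lemma mem_residuals {α : Config J} (hα : α ∈ m.states) {j : Fin J} {x : ℝ} (hx : x ∈ α j) :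
    x ∈ m.residuals j := hα j x hx

lemma Positive.finite_states (hm : m.Positive) (n : ℕ) :
    {α ∈ m.states | α.count ≤ n}.Finite := by
  have h1 : ∀ j, {l : List ℝ | l.length ≤ n ∧ ∀ x ∈ l, x ∈ m.residuals j}.Finite := by
    intro j
    have := (hm.finite_residuals j).to_subtype
    refine ((List.finite_length_le (m.residuals j) n).image (List.map Subtype.val)).subset ?_
    rintro l ⟨hl, hx⟩
    refine ⟨l.attach.map fun x => ⟨x.1, hx x.1 x.2⟩, by simpa using hl, ?_⟩
    simp
  refine (Set.Finite.pi' h1).subset ?_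
  rintro α ⟨hα, hn⟩ j
  refine ⟨le_trans ?_ hn, hα j⟩
  exact Finset.single_le_sum (f := fun j => (α j).length) (fun _ _ => Nat.zero_le _)
    (Finset.mem_univ j)

/-! ### Additive functions of the residual requirements -/

/-- A family of monotone functions of the residual requirement, positive for a message that is
present and zero for a message that has left. -/
structure IsWeight (v : Fin J → ℝ → ℝ) : Prop where
  mono : ∀ j, Monotone (v j)
  zero : ∀ j x, x ≤ 0 → v j x = 0
  pos : ∀ j x, 0 < x → 0 < v j x

/-- The total weight of the messages in the system. -/
noncomputable def potential (v : Fin J → ℝ → ℝ) (α : Config J) : ℝ := ∑ j, ((α j).map (v j)).sum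

variable {v : Fin J → ℝ → ℝ}

lemma IsWeight.nonneg (hv : IsWeight v) (j : Fin J) (x : ℝ) : 0 ≤ v j x := by
  rcases le_or_gt x 0 with h | h
  · exact (hv.zero j x h).ge
  · exact (hv.pos j x h).le

lemma IsWeight.potential_nonneg (hv : IsWeight v) (α : Config J) : 0 ≤ potential v α := by
  refine Finset.sum_nonneg fun j _ => List.sum_nonneg fun y hy => ?_
  obtain ⟨x, _, rfl⟩ := List.mem_map.mp hy
  exact hv.nonneg j x

/-- The weight takes finitely many values on residuals, all positive, so their minimum serves as c.
-/
lemma IsWeight.exists_le_potential (hv : IsWeight v) (hm : m.Positive) :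
    ∃ c : ℝ, 0 < c ∧ ∀ α ∈ m.states, c * α.count ≤ potential v α := by
  have h1 : ∃ c : ℝ, 0 < c ∧ ∀ j, ∀ x ∈ m.residuals j, c ≤ v j x := by
    have hfin : (⋃ j, v j '' m.residuals j).Finite :=
      Set.finite_iUnion fun j => (hm.finite_residuals j).image _
    rcases (⋃ j, v j '' m.residuals j).eq_empty_or_nonempty with h | h
    · refine ⟨1, one_pos, fun j x hx => ?_⟩
      have : v j x ∈ ⋃ j, v j '' m.residuals j := Set.mem_iUnion.mpr ⟨j, x, hx, rfl⟩
      simp [h] at this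
    · obtain ⟨c, hc, hmin⟩ := Set.exists_min_image _ id hfin h
      refine ⟨c, ?_, fun j x hx => hmin _ (Set.mem_iUnion.mpr ⟨j, x, hx, rfl⟩)⟩
      obtain ⟨j, x, hx, rfl⟩ := Set.mem_iUnion.mp hc
      exact hv.pos j x hx.1
  obtain ⟨c, hc, hmin⟩ := h1
  refine ⟨c, hc, fun α hα => ?_⟩
  rw [Config.count, potential, Nat.cast_sum, Finset.mul_sum]
  refine Finset.sum_le_sum fun j _ => ?_
  have := List.sum_map_add_le (f := v j) (g := fun _ => 0) (r := c) (α j)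
    fun x hx => by simpa using hmin j x (mem_residuals hα hx)
  simp only [List.map_const', List.sum_replicate, smul_zero, zero_add] at this
  linarith

lemma IsWeight.exists_potential_le (hv : IsWeight v) (hm : m.Positive) :
    ∃ c : ℝ, 0 ≤ c ∧ ∀ α ∈ m.states, potential v α ≤ c * α.count := by
  have hnn : ∀ j, 0 ≤ v j (m.requirement j) := fun j => hv.nonneg j _
  refine ⟨∑ j, v j (m.requirement j), Finset.sum_nonneg fun j _ => hnn j, fun α hα => ?_⟩
  rw [Config.count, potential, Nat.cast_sum, Finset.mul_sum]
  refine Finset.sum_le_sum fun j _ => ?_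
  have h1 : v j (m.requirement j) ≤ ∑ j, v j (m.requirement j) :=
    Finset.single_le_sum (f := fun j => v j (m.requirement j)) (fun j _ => hnn j)
      (Finset.mem_univ j)
  have := List.sum_map_add_le (g := v j) (f := fun _ => 0)
    (r := -∑ j, v j (m.requirement j)) (α j) fun x hx => by
      have := hv.mono j (hm.le_requirement (mem_residuals hα hx))
      linarith
  simp only [List.map_const', List.sum_replicate, smul_zero] at this
  linarith

lemma IsWeight.potential_step (hv : IsWeight v) (α : Config J) (s : Schedule J)
    (a : Fin J → ℕ) : potential v (m.step α s a)
      = ∑ j, ((((α j).take (s j)).map fun x => v j (x - m.quantum s j)).sum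
          + (((α j).drop (s j)).map (v j)).sum)
        + batchWork (fun j => v j (m.requirement j)) a := by
  rw [potential, batchWork, ← Finset.sum_add_distrib]
  refine Finset.sum_congr rfl fun j _ => ?_
  -- Departures do not change the total, since only messages of weight zero are removed.
  have h1 : ∀ l : List ℝ, ((l.filter fun x => 0 < x).map (v j)).sum = (l.map (v j)).sum := by
    intro l
    induction l with
    | nil => simp
    | cons x l ih =>
      by_cases hx : 0 < x
      · simp [hx, ← ih]
      · simp [hx, ih, hv.zero j x (not_lt.mp hx)]
  simp only [step, List.map_append, List.sum_append, h1, List.map_map, List.map_replicate,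
    List.sum_replicate, nsmul_eq_mul]
  rfl

lemma potential_eq (v : Fin J → ℝ → ℝ) (α : Config J) (s : Schedule J) :
    potential v α = ∑ j, ((((α j).take (s j)).map (v j)).sum
      + (((α j).drop (s j)).map (v j)).sum) := by
  refine Finset.sum_congr rfl fun j _ => ?_
  rw [← List.sum_append, ← List.map_append, List.take_append_drop]

lemma IsWeight.potential_step_le (hv : IsWeight v) {α : Config J} (hα : α ∈ m.states)
    {s : Schedule J} (hs : ∀ j, s j ≤ (α j).length) {r : Fin J → ℝ}
    (hr : ∀ j, 0 < s j → ∀ x, 0 < x → v j (x - m.quantum s j) + r j ≤ v j x)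
    (a : Fin J → ℕ) : potential v (m.step α s a)
      ≤ potential v α - ∑ j, s j * r j + batchWork (fun j => v j (m.requirement j)) a := by
  rw [hv.potential_step, potential_eq v α s, ← Finset.sum_sub_distrib]
  gcongr with j
  rcases Nat.eq_zero_or_pos (s j) with h0 | h0
  · simp [h0]
  have := List.sum_map_add_le (f := v j) (g := fun x => v j (x - m.quantum s j)) (r := r j)
    ((α j).take (s j)) fun x hx => hr j h0 x (hα j x (List.mem_of_mem_take hx)).1
  rw [List.length_take_of_le (hs j)] at this
  linarith

lemma IsWeight.le_potential_step (hv : IsWeight v) {α : Config J} (hα : α ∈ m.states)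
    {s : Schedule J} (hs : ∀ j, s j ≤ (α j).length) {r : Fin J → ℝ}
    (hr : ∀ j, 0 < s j → ∀ x, 0 < x → v j x ≤ v j (x - m.quantum s j) + r j)
    (a : Fin J → ℕ) :
    potential v α - ∑ j, s j * r j + batchWork (fun j => v j (m.requirement j)) a
      ≤ potential v (m.step α s a) := by
  rw [hv.potential_step, potential_eq v α s, ← Finset.sum_sub_distrib]
  gcongr with j
  rcases Nat.eq_zero_or_pos (s j) with h0 | h0
  · simp [h0]
  have := List.sum_map_add_le (g := v j) (f := fun x => v j (x - m.quantum s j)) (r := -r j)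
    ((α j).take (s j)) fun x hx => by
      linarith [hr j h0 x (hα j x (List.mem_of_mem_take hx)).1]
  rw [List.length_take_of_le (hs j)] at this
  linarith

/-! ### Drift criteria -/

lemma tsum_chain_mul (p : Fin J → PMF ℕ) (ω : Config J → PMF (Schedule J)) (α : Config J)
    (g : Config J → ℝ≥0∞) : ∑' β, m.chain p ω α β * g β
      = ∑' s, ω α s * ∑' a, batchLaw p a * g (m.step α s a) := by
  simp only [chain, PMF.tsum_bind_mul, PMF.tsum_map_mul]

variable {p : Fin J → PMF ℕ} {ω : Config J → PMF (Schedule J)} {C : Set (Config J)}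

/-- The chain is stable if every full schedule reduces the total weight by at least `σ`, up to
arrivals, and the mean weight of the arrivals is less than `σ`. -/
theorem IsWeight.stable (hv : IsWeight v) (hm : m.Positive)
    (hp : ∀ j, FiniteSecondMoment (p j)) (hω : m.NonIdling ω) (hC : C ⊆ m.states)
    (hirr : MarkovChain.IrreducibleOn (m.chain p ω) C) {σ : ℝ}
    (hserv : ∀ s : Schedule J, ∑ j, s j = m.K → ∃ r : Fin J → ℝ,
      (∀ j, 0 < s j → ∀ x, 0 < x → v j (x - m.quantum s j) + r j ≤ v j x) ∧
      σ ≤ ∑ j, s j * r j)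
    (hload : ∑ j, meanBatch (p j) * v j (m.requirement j) < σ) : m.Stable p ω C := by
  obtain ⟨c, hc, hcV⟩ := hv.exists_le_potential hm
  set V : Config J → ℝ := potential v with hVdef
  set w : Fin J → ℝ := fun j => v j (m.requirement j) with hw
  have hw0 : ∀ j, 0 ≤ w j := fun j => hv.nonneg j _
  have hV0 : ∀ α, 0 ≤ V α := hv.potential_nonneg
  set e := ∑ j, meanBatch (p j) * w j with he
  have he0 : 0 ≤ e := Finset.sum_nonneg fun j _ => mul_nonneg (meanBatch_nonneg _) (hw0 j)
  set B := meanSqWork p w with hB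
  have hγ : 0 < σ - e := by simpa [he, hw] using hload
  -- Above n messages the schedule is full, V ≥ σ, and half of the drift -2(σ-e)V covers the
  -- constant 1 + σ² + B; the other half covers the part of the cost that is linear in the count.
  obtain ⟨n, hn⟩ := exists_nat_ge (max (m.K : ℝ) (max (σ / c) ((1 + σ ^ 2 + B) / ((σ - e) * c))))
  have hn1 : m.K ≤ n := by exact_mod_cast (le_max_left _ _).trans hn
  have hn2 : σ ≤ c * n := by
    have := (le_max_left _ _).trans ((le_max_right _ _).trans hn)
    rwa [div_le_iff₀' hc] at this
  have hn3 : 1 + σ ^ 2 + B ≤ (σ - e) * c * n := by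
    have := (le_max_right _ _).trans ((le_max_right _ _).trans hn)
    rwa [div_le_iff₀' (by positivity)] at this
  have hfin : {α ∈ C | α.count ≤ n}.Finite :=
    (hm.finite_states n).subset fun α hα => ⟨hC hα.1, hα.2⟩
  set f : Config J → ℝ≥0∞ := fun α => ENNReal.ofReal (1 + (σ - e) * c * α.count) with hf
  have key : MarkovChain.PositiveRecurrentOn (m.chain p ω) C ∧ ∃ μ : PMF (Config J),
      MarkovChain.StationaryOn (m.chain p ω) C μ ∧ ∑' α, μ α * f α ≠ ⊤ := by
    refine hirr.positiveRecurrentOn (W := fun α => ENNReal.ofReal (V α ^ 2)) hfin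
      (fun α hα => hα.1) ?_ ?_ ?_ ?_
    · intro α
      rw [hf, ← ENNReal.ofReal_one]
      refine ENNReal.ofReal_le_ofReal ?_
      have : 0 ≤ (σ - e) * c * α.count := by positivity
      linarith
    · exact fun _ _ => ENNReal.ofReal_ne_top
    · rintro α ⟨hα, -⟩
      refine ENNReal.add_ne_top.mpr ⟨ENNReal.ofReal_ne_top, ?_⟩
      refine ne_top_of_le_ne_top
        (b := ENNReal.ofReal (V α ^ 2 + 2 * V α * e + 1 * B)) ENNReal.ofReal_ne_top ?_
      rw [tsum_chain_mul]
      refine PMF.tsum_mul_le _ fun s hs => ?_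
      rw [← tsum_batchLaw_mul_quadratic hp hw0 (sq_nonneg _) (by linarith [hV0 α]) zero_le_one]
      refine ENNReal.tsum_le_tsum fun a => mul_le_mul_right (ENNReal.ofReal_le_ofReal ?_) _
      -- On the finite set only finiteness of the mean is needed, so service is credited with
      -- nothing.
      have h1 := hv.potential_step_le (hC hα) (hω.feasible α (hC hα) s hs) (r := fun _ => 0)
        (fun j _ x _ => by
          simpa using hv.mono j (sub_le_self x (hm.quantum_nonneg s j))) a
      simp only [mul_zero, Finset.sum_const_zero, sub_zero] at h1
      calc V (m.step α s a) ^ 2 ≤ (V α + batchWork w a) ^ 2 := by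
            gcongr
            exact hV0 _
        _ = _ := by ring
    · intro α hα hαn
      have hcount : n < α.count := not_le.mp fun h => hαn ⟨hα, h⟩
      have hcount' : (n : ℝ) ≤ α.count := by exact_mod_cast hcount.le
      have hVc := hcV α (hC hα)
      have hVσ : 0 ≤ V α - σ := by nlinarith
      have hstep : ∑' β, m.chain p ω α β * ENNReal.ofReal (V β ^ 2)
          ≤ ENNReal.ofReal ((V α - σ) ^ 2 + 2 * (V α - σ) * e + 1 * B) := by
        rw [tsum_chain_mul]
        refine PMF.tsum_mul_le _ fun s hs => ?_
        rw [← tsum_batchLaw_mul_quadratic hp hw0 (sq_nonneg _) (by linarith) zero_le_one]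
        refine ENNReal.tsum_le_tsum fun a => mul_le_mul_right (ENNReal.ofReal_le_ofReal ?_) _
        obtain ⟨r, hr, hσ⟩ := hserv s (hω.eq_K α (hC hα) (hn1.trans hcount.le) s hs)
        have h1 := hv.potential_step_le (hC hα) (hω.feasible α (hC hα) s hs) hr a
        calc V (m.step α s a) ^ 2 ≤ (V α - σ + batchWork w a) ^ 2 := by
              refine pow_le_pow_left₀ (hV0 _) ?_ 2
              linarith
          _ = _ := by ring
      refine (add_le_add le_rfl hstep).trans ?_
      have hB0 : 0 ≤ B := meanSqWork_nonneg
      rw [hf, ← ENNReal.ofReal_add (by positivity) (by positivity)]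
      refine ENNReal.ofReal_le_ofReal ?_
      have h2 : (σ - e) * (c * α.count) ≤ (σ - e) * V α := by gcongr
      have h3 : (σ - e) * c * n ≤ (σ - e) * c * α.count := by gcongr
      have h4 : 0 ≤ σ * e := mul_nonneg (by linarith) he0
      nlinarith
  obtain ⟨hrec, μ, hμ, hμf⟩ := key
  refine ⟨hrec, μ, hμ, fun htop => hμf ?_⟩
  have hk : ENNReal.ofReal ((σ - e) * c) ≠ 0 := by
    simpa using mul_pos hγ hc
  rw [eq_top_iff]
  calc ⊤ = ENNReal.ofReal ((σ - e) * c) * ∑' α, μ α * (α.count : ℝ≥0∞) := by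
        rw [htop, ENNReal.mul_top hk]
    _ ≤ _ := by
        rw [← ENNReal.tsum_mul_left]
        refine ENNReal.tsum_le_tsum fun α => ?_
        rw [mul_left_comm]
        gcongr
        rw [hf, ← ENNReal.ofReal_natCast, ← ENNReal.ofReal_mul (by positivity)]
        exact ENNReal.ofReal_le_ofReal (by linarith)

/-- The chain is unstable if every full schedule reduces the total weight by at most `σ`, up to
arrivals, and the mean weight of the arrivals is greater than `σ`. -/
theorem IsWeight.unstable (hv : IsWeight v) (hm : m.Positive)
    (hp : ∀ j, FiniteSecondMoment (p j)) (hω : m.NonIdling ω) (hC : C ⊆ m.states)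
    (hirr : MarkovChain.IrreducibleOn (m.chain p ω) C) (hunb : ∀ b : ℕ, ∃ α ∈ C, b ≤ α.count)
    {σ : ℝ} (hσ : 0 ≤ σ)
    (hserv : ∀ s : Schedule J, ∑ j, s j = m.K → ∃ r : Fin J → ℝ,
      (∀ j, 0 < s j → ∀ x, 0 < x → v j x ≤ v j (x - m.quantum s j) + r j) ∧
      ∑ j, s j * r j ≤ σ)
    (hload : σ < ∑ j, meanBatch (p j) * v j (m.requirement j)) : m.Unstable p ω C := by
  obtain ⟨c, hc, hcV⟩ := hv.exists_le_potential hm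
  obtain ⟨d, hd, hdV⟩ := hv.exists_potential_le hm
  set V : Config J → ℝ := potential v with hVdef
  set w : Fin J → ℝ := fun j => v j (m.requirement j) with hw
  obtain ⟨θ, hθ, hexp⟩ := exists_tsum_batchLaw_mul_exp_le hp (fun j => hv.nonneg j _) hσ hload
  set h : Config J → ℝ≥0∞ := fun α => ENNReal.ofReal (Real.exp (-(θ * V α))) with hh
  have hlt : ∀ {x y : ℝ}, x < y →
      ENNReal.ofReal (Real.exp (-(θ * y))) < ENNReal.ofReal (Real.exp (-(θ * x))) := by
    intro x y hxy
    refine (ENNReal.ofReal_lt_ofReal_iff (Real.exp_pos _)).mpr (Real.exp_lt_exp.mpr ?_)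
    nlinarith
  -- With fewer than K messages V ≤ dK, so truncation at this level makes the function maximal
  -- wherever the schedule need not be full, and superharmonicity there is automatic.
  set k := ENNReal.ofReal (Real.exp (-(θ * (d * m.K)))) with hk
  obtain ⟨α₀, hα₀⟩ := hirr.nonempty
  obtain ⟨b, hb⟩ := exists_nat_gt (max (d * m.K) (V α₀) / c)
  obtain ⟨α₁, hα₁, hb₁⟩ := hunb b
  have hbig : max (d * m.K) (V α₀) < V α₁ := by
    rw [div_lt_iff₀' hc] at hb
    have : (b : ℝ) ≤ α₁.count := by exact_mod_cast hb₁
    have := hcV α₁ (hC hα₁)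
    nlinarith
  refine hirr.transientOn (g := fun α => min (h α) k) (a := α₁) (b := α₀)
    (fun α _ => ne_top_of_le_ne_top ENNReal.ofReal_ne_top (min_le_left _ _)) ?_ hα₁ hα₀ ?_
  · intro α hα
    refine le_min ?_ (PMF.tsum_mul_le _ fun β _ => min_le_right _ _)
    rcases lt_or_ge α.count m.K with hlow | hhigh
    · refine le_trans (PMF.tsum_mul_le _ fun β _ => min_le_right _ _) (b := k) ?_
      refine ENNReal.ofReal_le_ofReal (Real.exp_le_exp.mpr ?_)
      have h1 := hdV α (hC hα)
      have h2 : (α.count : ℝ) ≤ m.K := by exact_mod_cast hlow.le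
      have h3 : V α ≤ d * m.K := h1.trans (by gcongr)
      nlinarith
    · refine le_trans (ENNReal.tsum_le_tsum fun β => mul_le_mul_right (min_le_left _ _) _) ?_
      rw [tsum_chain_mul]
      refine PMF.tsum_mul_le _ fun s hs => ?_
      obtain ⟨r, hr, hrσ⟩ := hserv s (hω.eq_K α (hC hα) hhigh s hs)
      calc ∑' a, batchLaw p a * h (m.step α s a)
          ≤ ∑' a, h α * (batchLaw p a
              * ENNReal.ofReal (Real.exp (-(θ * (batchWork w a - σ))))) := by
            refine ENNReal.tsum_le_tsum fun a => ?_
            rw [mul_left_comm]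
            gcongr
            rw [hh, ← ENNReal.ofReal_mul (Real.exp_pos _).le, ← Real.exp_add]
            refine ENNReal.ofReal_le_ofReal (Real.exp_le_exp.mpr ?_)
            have h1 := hv.le_potential_step (hC hα) (hω.feasible α (hC hα) s hs) hr a
            have h2 : V α - σ + batchWork w a ≤ V (m.step α s a) := by linarith
            nlinarith
        _ ≤ h α * 1 := by rw [ENNReal.tsum_mul_left]; gcongr
        _ = h α := mul_one _
  · refine ne_of_lt (lt_of_le_of_lt (min_le_left _ _) (lt_min ?_ ?_))
    · exact hlt ((le_max_right _ _).trans_lt hbig)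
    · exact hlt ((le_max_left _ _).trans_lt hbig)

end Model

/-! ### One class -/

namespace Model

/-- The number of slots that a requirement takes with the quantum `q` is a weight. -/
lemma isWeight_ceil {J : ℕ} {q : ℝ} (hq : 0 < q) :
    IsWeight (J := J) fun _ x => (⌈x / q⌉₊ : ℝ) where
  mono _ x y hxy := by
    have : x / q ≤ y / q := by gcongr
    exact Nat.cast_le.mpr (Nat.ceil_mono this)
  zero _ x hx := by
    exact_mod_cast Nat.ceil_eq_zero.mpr (div_nonpos_of_nonpos_of_nonneg hx hq.le)
  pos _ x hx := by exact_mod_cast Nat.ceil_pos.mpr (div_pos hx hq)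

lemma ceil_sub_div_add_one {q x : ℝ} (hq : 0 < q) (hx : 0 < x) :
    (⌈(x - q) / q⌉₊ : ℝ) + 1 = ⌈x / q⌉₊ := by
  have h1 : (x - q) / q = x / q - 1 := by field_simp
  -- Positivity matters because the subtraction of 1 from the natural ceiling is truncated.
  have h2 : 0 < ⌈x / q⌉₊ := Nat.ceil_pos.mpr (div_pos hx hq)
  rw [h1, Nat.ceil_sub_one]
  exact_mod_cast Nat.sub_add_cancel h2

/-- With one class and a constant quantum under the full schedule, the stability threshold is
attained when `K` slots of work arrive per slot on average. -/
theorem threshold_of_one_class (m : Model 1) (hm : m.Positive) (hM : 2 ≤ m.M 0)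
    (hpe : 0 < m.pe 0) (hpe1 : m.pe 0 ≤ 1) {q : ℝ} (hq : 0 < q)
    (hquant : ∀ s : Schedule 1, s 0 = m.K → m.quantum s 0 = q) :
    m.StableBelow (m.K * Real.log (m.M 0) / ⌈m.requirement 0 / q⌉₊) ∧
      m.UnstableAbove (m.K * Real.log (m.M 0) / ⌈m.requirement 0 / q⌉₊) := by
  have hlog : 0 < Real.log (m.M 0) := Real.log_pos (by exact_mod_cast hM)
  have hreq : 0 < m.requirement 0 := by
    have := Real.log_nonpos hpe.le hpe1
    have := mul_pos hm.ρ hlog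
    unfold requirement
    linarith
  have hN : (0 : ℝ) < ⌈m.requirement 0 / q⌉₊ := (isWeight_ceil (J := 1) hq).pos 0 _ hreq
  have hfull : ∀ s : Schedule 1, ∑ j, s j = m.K → s 0 = m.K := fun s hs => by simpa using hs
  constructor
  · intro p ω C hp hω hC hirr hrate
    refine (isWeight_ceil hq).stable hm hp hω hC hirr (σ := m.K) (fun s hs => ?_) ?_
    · refine ⟨fun _ => 1, fun j _ x hx => ?_, ?_⟩
      · rw [Subsingleton.elim j 0, hquant s (hfull s hs), ceil_sub_div_add_one hq hx]
      · simp [hfull s hs]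
    · rw [natRate, Fin.sum_univ_one, lt_div_iff₀ hN] at hrate
      rw [Fin.sum_univ_one]
      nlinarith
  · intro p ω C hp hω hC hirr hunb hrate
    refine (isWeight_ceil hq).unstable hm hp hω hC hirr hunb (σ := m.K) (Nat.cast_nonneg _)
      (fun s hs => ?_) ?_
    · refine ⟨fun _ => 1, fun j _ x hx => ?_, ?_⟩
      · rw [Subsingleton.elim j 0, hquant s (hfull s hs), ceil_sub_div_add_one hq hx]
      · simp [hfull s hs]
    · rw [natRate, Fin.sum_univ_one, div_lt_iff₀ hN] at hrate
      rw [Fin.sum_univ_one]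
      nlinarith

/-- Rounding up is asymptotically negligible because the argument of the ceiling tends to infinity,
and the constant c is lost against ρ ln M. -/
lemma tendsto_log_div_ceil (K c ρ q : ℝ) (hρ : 0 < ρ) (hq : 0 < q) :
    Tendsto (fun M : ℕ => K * Real.log M / ⌈(c + ρ * Real.log M) / q⌉₊) atTop
      (𝓝 (K * (q / ρ))) := by
  have hlog : Tendsto (fun M : ℕ => Real.log M) atTop atTop :=
    Real.tendsto_log_atTop.comp tendsto_natCast_atTop_atTop
  have hy : Tendsto (fun M : ℕ => (c + ρ * Real.log M) / q) atTop atTop :=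
    (tendsto_atTop_add_const_left _ c (hlog.const_mul_atTop hρ)).atTop_div_const hq
  have h1 := (tendsto_nat_ceil_div_atTop (R := ℝ)).comp hy
  have h2 : Tendsto (fun M : ℕ => q / (c / Real.log M + ρ)) atTop (𝓝 (q / (0 + ρ))) :=
    tendsto_const_nhds.div (((tendsto_const_nhds (x := c)).div_atTop hlog).add_const ρ)
      (by simpa using hρ.ne')
  have h3 := (h2.const_mul K).div h1 one_ne_zero
  rw [zero_add, div_one] at h3
  refine h3.congr' ?_
  filter_upwards [hlog.eventually_gt_atTop 0, hy.eventually_gt_atTop 0] with M hM hyM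
  have h4 : c / Real.log M + ρ = (c + ρ * Real.log M) / Real.log M := by field_simp
  have h5 : 0 < c + ρ * Real.log M := by simpa [div_mul_cancel₀ _ hq.ne'] using mul_pos hyM hq
  simp only [Pi.div_apply, Function.comp_apply, h4]
  have h6 : (0 : ℝ) < ⌈(c + ρ * Real.log M) / q⌉₊ := by exact_mod_cast Nat.ceil_pos.mpr hyM
  field_simp

/-! ### Many classes -/

/-- The total service of a schedule of large total power is close to `ρ / (1 + ρ)`, and its
quanta are at most `1`. -/
lemma Positive.service_bounds {J : ℕ} {m : Model J} (hm : m.Positive) (hρ1 : m.ρ ≤ 1) {b ε : ℝ}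
    (hε : 0 < ε) (hb0 : 0 < b) (hb : ∀ j, m.power j ≤ b) {s : Schedule J}
    (hs : 2 * b + 2 * b / ε + 2 * m.noise / ε ≤ ∑ k, (s k : ℝ) * m.power k) :
    (∀ j, m.quantum s j ≤ 1) ∧
      m.ρ * (1 / (1 + m.ρ)) - m.ρ * ε / 2 ≤ ∑ j, s j * m.quantum s j ∧
      ∑ j, s j * m.quantum s j ≤ m.ρ * (1 / (1 + m.ρ)) + m.ρ * ε / 2 := by
  have hρ := hm.ρ
  have hnoise := hm.noise
  set D := ∑ k, (s k : ℝ) * m.power k with hD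
  have hbε : 0 < 2 * b / ε := by positivity
  have hnε : 0 < 2 * m.noise / ε := by positivity
  have hD2 : 2 * b < D := by linarith
  have hDb : 2 * b ≤ ε * (D - b) := by
    rw [← div_le_iff₀' hε]; linarith
  have hDn : 2 * m.noise ≤ ε * D := by
    rw [← div_le_iff₀' hε]; linarith
  have hD0 : 0 < D := by linarith
  -- From ln(1+u) ≤ u, with the interference bounded below by D - b. The bound is linear in the
  -- power, so it sums over the schedule to a multiple of D.
  have hup : ∀ j, m.quantum s j ≤ m.ρ * (1 / (1 + m.ρ)) / (D - b) * m.power j := by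
    intro j
    have hpj := hm.power j
    have hbj := hb j
    have hDb0 : 0 < D - b := by linarith
    unfold quantum
    split_ifs with h
    · positivity
    · rw [← hD]
      have hden : 0 < D - m.power j + m.noise := by linarith
      have h1 := Real.log_le_sub_one_of_pos
        (x := 1 + m.power j / ((1 + m.ρ) * (D - m.power j + m.noise))) (by positivity)
      have h2 : m.power j / ((1 + m.ρ) * (D - m.power j + m.noise))
          ≤ m.power j / ((1 + m.ρ) * (D - b)) := by
        gcongr
        linarith
      calc _ ≤ m.ρ * (m.power j / ((1 + m.ρ) * (D - b))) := by
            gcongr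
            linarith
        _ = _ := by field_simp
  -- From ln y ≥ 1 - 1/y; the extra power in the resulting denominator is absorbed because it is at
  -- most (1+ρ) times itself.
  have hlow : ∀ j, s j ≠ 0 → m.ρ * (1 / (1 + m.ρ)) / (D + m.noise) * m.power j
      ≤ m.quantum s j := by
    intro j h
    have hpj := hm.power j
    have hbj := hb j
    have hden : 0 < D - m.power j + m.noise := by linarith
    rw [quantum, if_neg h, ← hD]
    have h1 := Real.one_sub_inv_le_log_of_pos
      (x := 1 + m.power j / ((1 + m.ρ) * (D - m.power j + m.noise))) (by positivity)
    have h2 : m.power j / ((1 + m.ρ) * (D + m.noise))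
        ≤ 1 - (1 + m.power j / ((1 + m.ρ) * (D - m.power j + m.noise)))⁻¹ := by
      have h3 : 1 - (1 + m.power j / ((1 + m.ρ) * (D - m.power j + m.noise)))⁻¹
          = m.power j / ((1 + m.ρ) * (D - m.power j + m.noise) + m.power j) := by
        field_simp
        ring
      rw [h3]
      gcongr
      nlinarith
    calc _ = m.ρ * (m.power j / ((1 + m.ρ) * (D + m.noise))) := by field_simp
      _ ≤ _ := by
        gcongr
        exact h2.trans h1
  have hsum : ∀ x : ℝ, ∑ j, (s j : ℝ) * (x * m.power j) = x * D := by
    intro x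
    rw [hD, Finset.mul_sum]
    exact Finset.sum_congr rfl fun j _ => by ring
  have hL1 : 1 / (1 + m.ρ) ≤ 1 := by
    rw [div_le_one (by positivity)]; linarith
  have hL0 : 0 < 1 / (1 + m.ρ) := by positivity
  set L := 1 / (1 + m.ρ) with hL
  refine ⟨fun j => (hup j).trans ?_, ?_, ?_⟩
  · have h1 : m.ρ * L ≤ 1 := by nlinarith
    rw [div_mul_eq_mul_div, div_le_one (by linarith)]
    have := hb j
    have := hm.power j
    nlinarith
  · have h1 : m.ρ * L / (D + m.noise) * D ≤ ∑ j, s j * m.quantum s j := by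
      rw [← hsum]
      refine Finset.sum_le_sum fun j _ => ?_
      by_cases h : s j = 0
      · simp [h]
      · gcongr
        exact hlow j h
    refine le_trans ?_ h1
    rw [div_mul_eq_mul_div, le_div_iff₀ (by positivity)]
    have h2 : L * m.noise ≤ ε / 2 * (D + m.noise) := by nlinarith
    nlinarith
  · have h1 : ∑ j, s j * m.quantum s j ≤ m.ρ * L / (D - b) * D := by
      rw [← hsum]
      refine Finset.sum_le_sum fun j _ => ?_
      gcongr
      exact hup j
    refine h1.trans ?_
    rw [div_mul_eq_mul_div, div_le_iff₀ (by linarith)]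
    have h2 : L * b ≤ ε / 2 * (D - b) := by nlinarith
    nlinarith

/-- The extra 1 compensates for the part of the last quantum wasted at departure: with quanta at
most 1, every service lowers the weight by at least the full quantum. -/
lemma isWeight_add_one {J : ℕ} : IsWeight (J := J) fun _ x => if 0 < x then x + 1 else 0 where
  mono _ x y hxy := by
    dsimp only
    split_ifs <;> linarith
  zero _ x hx := if_neg (not_lt.mpr hx)
  pos _ x hx := by rw [if_pos hx]; linarith

/-- Used for instability: a service lowers the positive part by at most the quantum. -/
lemma isWeight_max {J : ℕ} : IsWeight (J := J) fun _ x => max x 0 where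
  mono _ _ _ hxy := max_le_max_right 0 hxy
  zero _ _ hx := max_eq_right hx
  pos _ _ hx := lt_max_of_lt_left hx

/-- With many simultaneous transmissions and large alphabets, the total nat arrival rate has a
stability threshold close to `1 / (1 + ρ)`. -/
theorem threshold_of_large {J : ℕ} (m : Model J) (hm : m.Positive) (hρ1 : m.ρ ≤ 1)
    (hpe : ∀ j, 0 < m.pe j) (hpe1 : ∀ j, m.pe j ≤ 1) {a b ε : ℝ} (hε : 0 < ε)
    (hb0 : 0 < b) (ha : ∀ j, a ≤ m.power j) (hb : ∀ j, m.power j ≤ b)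
    (hM : ∀ j, -Real.log (m.pe j) + 1 ≤ m.ρ * ε / 2 * Real.log (m.M j))
    (hK : 2 * b + 2 * b / ε + 2 * m.noise / ε ≤ m.K * a) :
    m.StableBelow (1 / (1 + m.ρ) - ε) ∧ m.UnstableAbove (1 / (1 + m.ρ) + ε) := by
  have hρ := hm.ρ
  have hpow : ∀ s : Schedule J, ∑ j, s j = m.K →
      2 * b + 2 * b / ε + 2 * m.noise / ε ≤ ∑ k, (s k : ℝ) * m.power k := by
    intro s hs
    refine hK.trans ?_
    rw [← hs, Nat.cast_sum, Finset.sum_mul]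
    gcongr with j
    exact ha j
  have hserv := fun s hs => hm.service_bounds hρ1 hε hb0 hb (hpow s hs)
  have hlogpe : ∀ j, 0 ≤ -Real.log (m.pe j) := fun j => by
    have := Real.log_nonpos (hpe j).le (hpe1 j)
    linarith
  have hlogM : ∀ j, 0 ≤ Real.log (m.M j) := fun j => Real.log_natCast_nonneg _
  have hL1 : 1 / (1 + m.ρ) < 1 := by
    rw [div_lt_one (by positivity)]; linarith
  have hL0 : 0 < 1 / (1 + m.ρ) := by positivity
  set L := 1 / (1 + m.ρ) with hL
  constructor
  · intro p ω C hp hω hC hirr hrate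
    refine isWeight_add_one.stable hm hp hω hC hirr (σ := m.ρ * L - m.ρ * ε / 2)
      (fun s hs => ?_) ?_
    · obtain ⟨h1, h2, -⟩ := hserv s hs
      refine ⟨m.quantum s, fun j _ x hx => ?_, h2⟩
      have := h1 j
      rw [if_pos hx]
      split_ifs <;> linarith
    · have h0 : 0 ≤ m.natRate p :=
        Finset.sum_nonneg fun j _ => mul_nonneg (hlogM j) (meanBatch_nonneg _)
      have h1 : ∑ j, meanBatch (p j) *
          (if 0 < m.requirement j then m.requirement j + 1 else 0)
          ≤ (m.ρ + m.ρ * ε / 2) * m.natRate p := by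
        rw [natRate, Finset.mul_sum]
        refine Finset.sum_le_sum fun j _ => ?_
        have h2 := hM j
        have h3 : 0 ≤ m.requirement j :=
          add_nonneg (hlogpe j) (mul_nonneg hρ.le (hlogM j))
        have h4 : (if 0 < m.requirement j then m.requirement j + 1 else 0)
            ≤ (m.ρ + m.ρ * ε / 2) * Real.log (m.M j) := by
          have : m.requirement j + 1 ≤ (m.ρ + m.ρ * ε / 2) * Real.log (m.M j) := by
            unfold requirement
            linarith
          split_ifs <;> linarith
        calc _ ≤ meanBatch (p j) * ((m.ρ + m.ρ * ε / 2) * Real.log (m.M j)) :=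
              mul_le_mul_of_nonneg_left h4 (meanBatch_nonneg _)
          _ = _ := by ring
      refine h1.trans_lt ?_
      have h5 : m.ρ * m.natRate p < m.ρ * (L - ε) := mul_lt_mul_of_pos_left hrate hρ
      -- The rate is below L - ε < 1, so the overhead of requirements costs only ρε/2, leaving the
      -- other ρε/2 for the service error.
      have h6 : m.ρ * ε / 2 * m.natRate p ≤ m.ρ * ε / 2 * 1 := by
        gcongr
        linarith
      linarith
  · intro p ω C hp hω hC hirr hunb hrate
    refine isWeight_max.unstable hm hp hω hC hirr hunb (σ := m.ρ * L + m.ρ * ε / 2)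
      (by positivity) (fun s hs => ?_) ?_
    · obtain ⟨-, -, h2⟩ := hserv s hs
      refine ⟨m.quantum s, fun j _ x hx => ?_, h2⟩
      rw [max_eq_left hx.le]
      linarith [le_max_left (x - m.quantum s j) 0]
    · have h1 : m.ρ * m.natRate p ≤ ∑ j, meanBatch (p j) * max (m.requirement j) 0 := by
        rw [natRate, Finset.mul_sum]
        refine Finset.sum_le_sum fun j _ => ?_
        calc _ = meanBatch (p j) * (m.ρ * Real.log (m.M j)) := by ring
          _ ≤ _ := by
            refine mul_le_mul_of_nonneg_left (le_max_of_le_left ?_) (meanBatch_nonneg _)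
            unfold requirement
            linarith [hlogpe j]
      refine lt_of_lt_of_le ?_ h1
      have h5 : m.ρ * (L + ε) < m.ρ * m.natRate p := mul_lt_mul_of_pos_left hrate hρ
      have h6 : 0 < m.ρ * ε := by positivity
      linarith

end Model

/-! ### The two limits -/

theorem mainTheorem8 :
    (∀ (K : ℕ) (P N₀ W pe Γ : ℝ), 1 ≤ K → 0 < P → 0 < N₀ → 0 < W → 0 < pe → pe ≤ 1 →
      Γ = P / (N₀ * W) →
      ∃ (T : ℝ → ℕ → ℝ) (L : ℝ → ℝ),
        (∀ ρ : ℝ, 0 < ρ → ρ ≤ 1 → ∀ M : ℕ, 2 ≤ M →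
          (Model.mk (J := 1) K ρ (N₀ * W) (fun _ => P) (fun _ => M) (fun _ => pe)).StableBelow
            (T ρ M) ∧
          (Model.mk (J := 1) K ρ (N₀ * W) (fun _ => P) (fun _ => M) (fun _ => pe)).UnstableAbove
            (T ρ M)) ∧
        (∀ ρ : ℝ, 0 < ρ → ρ ≤ 1 → Tendsto (T ρ) atTop (𝓝 (L ρ))) ∧
        Tendsto L (𝓝[>] 0) (𝓝 (K * Real.log (1 + Γ / (((K : ℝ) - 1) * Γ + 1))))) ∧
    (∀ (J : ℕ) (P : Fin J → ℝ) (N₀ W : ℝ) (pe : Fin J → ℝ), 1 ≤ J → (∀ j, 0 < P j) →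
      0 < N₀ → 0 < W → (∀ j, 0 < pe j) → (∀ j, pe j ≤ 1) →
      ∃ L : ℝ → ℝ,
        (∀ ρ : ℝ, 0 < ρ → ρ ≤ 1 → ∀ ε : ℝ, 0 < ε →
          ∀ᶠ M₀ : ℕ in atTop, ∀ M : Fin J → ℕ, (∀ j, M₀ ≤ M j) →
            ∀ᶠ K : ℕ in atTop,
              (Model.mk K ρ (N₀ * W) P M pe).StableBelow (L ρ - ε) ∧
              (Model.mk K ρ (N₀ * W) P M pe).UnstableAbove (L ρ + ε)) ∧
        Tendsto L (𝓝[>] 0) (𝓝 1)) := by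
  constructor
  · intro K P N₀ W pe Γ hK hP hN₀ hW hpe hpe1 hΓ
    have hN : 0 < N₀ * W := mul_pos hN₀ hW
    have hK1 : (1 : ℝ) ≤ K := by exact_mod_cast hK
    have hD : 0 < K * P - P + N₀ * W := by nlinarith
    set c : ℝ → ℝ := fun ρ => Real.log (1 + P / ((1 + ρ) * (K * P - P + N₀ * W))) with hc
    have hc0 : ∀ ρ, 0 < ρ → 0 < c ρ := by
      intro ρ hρ
      refine Real.log_pos ?_
      have : 0 < P / ((1 + ρ) * (K * P - P + N₀ * W)) := by positivity
      linarith
    -- Here ρ c(ρ) is the quantum of the full schedule; the factor ρ cancels in the limit of large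
    -- M.
    refine ⟨fun ρ M => K * Real.log M / ⌈(-Real.log pe + ρ * Real.log M) / (ρ * c ρ)⌉₊,
      fun ρ => K * c ρ, ?_, ?_, ?_⟩
    · intro ρ hρ hρ1 M hM
      refine Model.threshold_of_one_class
        (Model.mk (J := 1) K ρ (N₀ * W) (fun _ => P) (fun _ => M) (fun _ => pe))
        ⟨hρ, hN, fun _ => hP⟩ hM hpe hpe1 (mul_pos hρ (hc0 ρ hρ)) fun s hs => ?_
      have hs' : s 0 = K := hs
      have hs0 : s 0 ≠ 0 := by omega
      rw [Model.quantum, if_neg hs0]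
      simp only [Fin.sum_univ_one, hs', hc]
    · intro ρ hρ _
      have := Model.tendsto_log_div_ceil K (-Real.log pe) ρ (ρ * c ρ) hρ (mul_pos hρ (hc0 ρ hρ))
      rwa [mul_div_cancel_left₀ _ hρ.ne'] at this
    · have h1 : ContinuousAt (fun ρ => K * c ρ) 0 := by
        refine continuousAt_const.mul (ContinuousAt.log ?_ ?_)
        · refine continuousAt_const.add (continuousAt_const.div (by fun_prop) ?_)
          simpa using hD.ne'
        · rw [add_zero, one_mul]; positivity
      have h2 : c 0 = Real.log (1 + Γ / (((K : ℝ) - 1) * Γ + 1)) := by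
        have h3 : ((K : ℝ) - 1) * Γ + 1 = (K * P - P + N₀ * W) / (N₀ * W) := by
          rw [hΓ]; field_simp
        rw [h3, hΓ, div_div_div_cancel_right₀ hN.ne']
        simp [hc]
      rw [← h2]
      exact h1.tendsto.mono_left nhdsWithin_le_nhds
  · intro J P N₀ W pe hJ hP hN₀ hW hpe hpe1
    have hN : 0 < N₀ * W := mul_pos hN₀ hW
    have : Nonempty (Fin J) := ⟨⟨0, hJ⟩⟩
    -- The least power makes the total power of K messages grow with K; the greatest bounds the
    -- power of any single message.
    obtain ⟨jmin, hmin⟩ := Finite.exists_min P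
    obtain ⟨jmax, hmax⟩ := Finite.exists_max P
    refine ⟨fun ρ => 1 / (1 + ρ), ?_, ?_⟩
    · intro ρ hρ hρ1 ε hε
      have hlog : Tendsto (fun M : ℕ => ρ * ε / 2 * Real.log M) atTop atTop :=
        (Real.tendsto_log_atTop.comp tendsto_natCast_atTop_atTop).const_mul_atTop (by positivity)
      have hM : ∀ᶠ M₀ : ℕ in atTop, ∀ j, ∀ M, M₀ ≤ M →
          -Real.log (pe j) + 1 ≤ ρ * ε / 2 * Real.log M :=
        eventually_all.mpr fun j =>
          eventually_forall_ge_atTop.mpr (hlog.eventually_ge_atTop _)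
      filter_upwards [hM] with M₀ hM₀ M hMM
      filter_upwards [(tendsto_natCast_atTop_atTop (R := ℝ)).atTop_mul_const (hP jmin)
        |>.eventually_ge_atTop (2 * P jmax + 2 * P jmax / ε + 2 * (N₀ * W) / ε)] with K hK
      exact Model.threshold_of_large (Model.mk K ρ (N₀ * W) P M pe) ⟨hρ, hN, hP⟩ hρ1 hpe hpe1
        hε (hP jmax) hmin hmax (fun j => hM₀ j (M j) (hMM j)) hK
    · have h1 : ContinuousAt (fun ρ : ℝ => 1 / (1 + ρ)) 0 :=
        continuousAt_const.div (by fun_prop) (by norm_num)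
      have h2 := h1.tendsto.mono_left (nhdsWithin_le_nhds (s := Set.Ioi 0))
      simpa using h2
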